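/- **Setting.** Write points of $\mathbb R^3$ as $(x_1,x_2,x_3)$. For $R\in\mathbb R$ let $\tau_R f(x)=f(x_1,x_2,x_3-R)$ on $L^2(\mathbb R^3)$. - Let $\mathcal K$ be the set of self-adjoint, locally trace class operators $\gamma$ on $L^2(\mathbb R^3)$ with $0\le\gamma\le1$ and $\tau_R\gamma=\gamma\tau_R$ for all $R\in\mathbb R$. - Let $\mathcal G$ be the set of self-adjoint, trace class operators $G\ge0$ on $L^2(\mathbb R^2)$. - For $f\in L^2(\mathbb R^3)$ let $(\mathcal Uf)_k=\frac1{\sqrt{2\pi}}\int_{\mathbb R}e^{-ikt}f(\cdot,\cdot,t)\,dt\in L^2(\mathbb R^2)$ be its partial Fourier transform in $x_3$. Each $\gamma\in\mathcal K$ has fibers $(\gamma_k)_{k\in\mathbb R}$, bounded operators on $L^2(\mathbb R^2)$, unique for almost every $k$, such that $(\mathcal U\gamma f)_k=\gamma_k(\mathcal Uf)_k$ for all $f\in L^2(\mathbb R^3)$ and almost every $k$. Write $\Lambda(\gamma)=\frac1{2\pi}\int_{\mathbb R}\gamma_k\,dk$ (weak integral). - The kinetic energy per unit length of $\gamma\in\mathcal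 K$ is $\underline{\mathcal E}^{\rm kin}(\gamma)=\frac12\underline{\rm Tr}(-\Delta_3\gamma)\in[0,+\infty]$, where $\underline{\rm Tr}$ is the trace per unit length in the $x_3$ direction, that is, $\underline{\rm Tr}(A)={\rm Tr}(\mathbf 1_QA\mathbf 1_Q)$ with $Q=\mathbb R^2\times(0,1)$. The operators $-\Delta_3\gamma$ and $-\Delta_2G$ are understood in the symmetric form $\sum_jP_j\gamma P_j$, resp. $\sum_jP_jGP_j$, with $P_j=-i\partial_j$, and their traces take values in $[0,+\infty]$. **Theorem.** Let $G\in\mathcal G$. Then, in $[0,+\infty]$, $$\inf_{\gamma\in\mathcal K,\ \Lambda(\gamma)=G}\underline{\mathcal E}^{\rm kin}(\gamma)=\frac12{\rm Tr}(-\Delta_2G)+\frac{\pi^2}6{\rm Tr}(G^3).$$ Moreover, $G$ can be written as $G=\sum_jg_j|\varphi_j\rangle\langle\varphi_j|$ with $(\varphi_j)_j$ an orthonormal family in $L^2(\mathbb R^2)$ and $g_j\ge0$. For every such decomposition, the infimum is attained by a $\gamma^*\in\mathcal K$ with $\Lambda(\gamma^*)=G$ whose fibers are $$\gamma_k^*=\sum_j\mathbf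 1_{\{|k|<\pi g_j\}}\,|\varphi_j\rangle\langle\varphi_j|,\qquad k\in\mathbb R.$$ -/

import Mathlib

open MeasureTheory
open scoped ENNReal ComplexInnerProductSpace Distributions FourierTransform

noncomputable section

/-- The plane `ℝ²` of the transverse variables `(x₁, x₂)`. -/
abbrev Plane : Type := EuclideanSpace ℝ (Fin 2)

/-- The space `ℝ³`, written as `ℝ² × ℝ` with points `((x₁, x₂), x₃)`; its volume is the Lebesgue
measure. The norm of the product is used nowhere, only its topology and smooth structure. -/
abbrev Space : Type := Plane × ℝ

/-- The complex Hilbert space `L²(X)`. -/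
abbrev L2 (X : Type) [MeasureSpace X] : Type := Lp ℂ 2 (volume : Measure X)

/-! ### Traces -/

section Trace

variable {H : Type} [NormedAddCommGroup H] [InnerProductSpace ℂ H]

/-- For a positive operator `A`, the trace of the compression of `A` to the closed subspace `S`, as
an element of `[0, ∞]`: the supremum of `∑ᵢ ⟨eᵢ, A eᵢ⟩` over finite orthonormal families in `S`. -/
def traceOn (S : Set H) (A : H →L[ℂ] H) : ℝ≥0∞ :=
  ⨆ (n : ℕ) (e : Fin n → H) (_ : Orthonormal ℂ e) (_ : ∀ i, e i ∈ S),
    ∑ i, ENNReal.ofReal (RCLike.re ⟪e i, A (e i)⟫)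

/-- The trace in `[0, ∞]` of a positive operator. -/
def posTrace (A : H →L[ℂ] H) : ℝ≥0∞ := traceOn Set.univ A

end Trace

/-! ### Kinetic energy -/

section Kinetic

variable {X : Type} [NormedAddCommGroup X] [NormedSpace ℝ X] [MeasureSpace X]
  [OpensMeasurableSpace X]
  [IsFiniteMeasureOnCompacts (volume : Measure X)]

theorem testFunction_memLp {Ω : TopologicalSpace.Opens X} (φ : 𝓓(Ω, ℂ)) :
    MemLp (fun x => φ x) 2 (volume : Measure X) :=
  φ.continuous.memLp_of_hasCompactSupport φ.hasCompactSupport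

theorem testFunction_memLp_fderiv {Ω : TopologicalSpace.Opens X} (φ : 𝓓(Ω, ℂ)) (v : X) :
    MemLp (fun x => fderiv ℝ φ x v) 2 (volume : Measure X) :=
  ((φ.contDiff.continuous_fderiv (by simp)).clm_apply
    continuous_const).memLp_of_hasCompactSupport (φ.hasCompactSupport.fderiv_apply ℝ v)

/-- A test function as an element of `L²`. -/
def testL2 {Ω : TopologicalSpace.Opens X} (φ : 𝓓(Ω, ℂ)) : L2 X := (testFunction_memLp φ).toLp _

/-- The partial derivative `∂_v φ` of a test function, as an element of `L²`. -/
def testDerivL2 {Ω : TopologicalSpace.Opens X} (φ : 𝓓(Ω, ℂ)) (v : X) : L2 X :=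
  (testFunction_memLp_fderiv φ v).toLp _

/-- For a positive operator `A` on `L²(X)` and directions `v₁, …, v_d`, the trace over an open set
`Ω`, in `[0, ∞]`, of the positive operator `-Δ A`, understood as usual in the symmetric form
`∑ⱼ Pⱼ A Pⱼ` with `Pⱼ = -i ∂_{vⱼ}`. In other words, the trace on `L²(Ω)` of the positive quadratic
form `φ ↦ ∑ⱼ ⟨∂ⱼ φ, A ∂ⱼ φ⟩` on `C_c^∞(Ω)`: the supremum of its sums over finite
`L²`-orthonormal families of test functions. It is infinite when `1_Ω (∑ⱼ Pⱼ A Pⱼ) 1_Ω` is not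
trace class. -/
def kineticTrace {d : ℕ} (v : Fin d → X) (Ω : TopologicalSpace.Opens X) (A : L2 X →L[ℂ] L2 X) :
    ℝ≥0∞ :=
  ⨆ (n : ℕ) (φ : Fin n → 𝓓(Ω, ℂ)) (_ : Orthonormal ℂ (fun i => testL2 (φ i))),
    ∑ i, ∑ j, ENNReal.ofReal
      (RCLike.re ⟪testDerivL2 (φ i) (v j), A (testDerivL2 (φ i) (v j))⟫)

end Kinetic

/-- `Tr(-Δ₂ G)` for a positive operator `G` on `L²(ℝ²)`. -/
def kineticTracePlane (G : L2 Plane →L[ℂ] L2 Plane) : ℝ≥0∞ :=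
  kineticTrace (fun j : Fin 2 => (EuclideanSpace.single j 1 : Plane)) ⊤ G

/-- The slab `ℝ² × (0, 1)` of unit length in the direction `x₃`. -/
def unitSlab : TopologicalSpace.Opens Space :=
  ⟨Set.univ ×ˢ Set.Ioo 0 1, isOpen_univ.prod isOpen_Ioo⟩

/-- The canonical basis of `ℝ³ = ℝ² × ℝ`. -/
def spaceBasis : Fin 3 → Space :=
  ![(EuclideanSpace.single 0 1, 0), (EuclideanSpace.single 1 1, 0), (0, 1)]

/-- The kinetic energy per unit length `½ Tr(-Δ₃ γ)` of a positive operator `γ` on `L²(ℝ³)`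
commuting with the translations along `x₃`. The trace per unit length is the trace over the slab
`ℝ² × (0, 1)`, that is, the integral over `ℝ²` of the density, which does not depend on `x₃`. -/
def kineticEnergy (γ : L2 Space →L[ℂ] L2 Space) : ℝ≥0∞ :=
  (1 / 2) * kineticTrace spaceBasis unitSlab γ

/-! ### Three-dimensional states -/

theorem measurePreserving_shift (R : ℝ) :
    MeasurePreserving (fun p : Space => ((p.1, p.2 - R) : Space)) volume volume :=
  (MeasurePreserving.id (volume : Measure Plane)).prod
    (measurePreserving_sub_right (volume : Measure ℝ) R)

/-- The translation `τ_R f (x) = f (x₁, x₂, x₃ - R)` on `L²(ℝ³)`. -/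
def translation (R : ℝ) : L2 Space →L[ℂ] L2 Space :=
  (Lp.compMeasurePreservingₗᵢ ℂ (fun p : Space => ((p.1, p.2 - R) : Space))
    (measurePreserving_shift R)).toContinuousLinearMap

/-- A positive operator `γ` on `L²(ℝ³)` is locally trace class: `1_K γ 1_K` has finite trace for
every compact set `K`. -/
def IsLocallyTraceClass (γ : L2 Space →L[ℂ] L2 Space) : Prop :=
  ∀ K : Set Space, IsCompact K →
    traceOn {f : L2 Space | ∀ᵐ x ∂(volume : Measure Space), x ∉ K → f x = 0} γ < ⊤

/-- The set `𝒦` of states: locally trace class (self-adjoint) operators on `L²(ℝ³)` with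
`0 ≤ γ ≤ 1`, in the sense of quadratic forms, which commute with all translations along `x₃`. -/
def states : Set (L2 Space →L[ℂ] L2 Space) :=
  {γ | IsLocallyTraceClass γ ∧ 0 ≤ γ ∧ γ ≤ 1 ∧
    ∀ R : ℝ, translation R ∘L γ = γ ∘L translation R}

/-- The set `𝒢` of reduced states: positive trace class operators on `L²(ℝ²)`. -/
def reducedStates : Set (L2 Plane →L[ℂ] L2 Plane) :=
  {G | 0 ≤ G ∧ posTrace G < ⊤}

/-! ### Partial Fourier transform and fibers -/

open Classical in
/-- The slice `f(·, t) ∈ L²(ℝ²)` of `f ∈ L²(ℝ³)`; for almost every `t` it is square integrable. -/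
def slice (f : L2 Space) (t : ℝ) : L2 Plane :=
  if h : MemLp (fun x : Plane => f (x, t)) 2 volume then h.toLp _ else 0

theorem stronglyMeasurable_section (f : L2 Space) (t : ℝ) :
    StronglyMeasurable (fun x : Plane => f (x, t)) :=
  (Lp.stronglyMeasurable f).comp_measurable measurable_prodMk_right

theorem memLp_section_iff (f : L2 Space) (t : ℝ) :
    MemLp (fun x : Plane => f (x, t)) 2 volume ↔ ∫⁻ x : Plane, ‖f (x, t)‖ₑ ^ (2 : ℝ) < ⊤ := by
  rw [MemLp, and_iff_right (stronglyMeasurable_section f t).aestronglyMeasurable,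
    eLpNorm_lt_top_iff_lintegral_rpow_enorm_lt_top (by simp) (by simp)]
  simp

theorem measurable_lintegral_section (f : L2 Space) (c : Plane → ℂ) (hc : StronglyMeasurable c) :
    Measurable (fun t : ℝ => ∫⁻ x : Plane, ‖f (x, t) - c x‖ₑ ^ (2 : ℝ)) := by
  have h : Measurable (fun p : Space => ‖f p - c p.1‖ₑ ^ (2 : ℝ)) :=
    (((Lp.stronglyMeasurable f).measurable.sub (hc.measurable.comp measurable_fst)).enorm).pow_const
      _
  exact h.lintegral_prod_left'

theorem lintegral_sections (f : L2 Space) :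
    ∫⁻ t : ℝ, ∫⁻ x : Plane, ‖f (x, t)‖ₑ ^ (2 : ℝ) < ⊤ := by
  have h1 := (eLpNorm_lt_top_iff_lintegral_rpow_enorm_lt_top (by simp) (by simp)).1
    (Lp.memLp f).eLpNorm_lt_top
  have h2 : Measurable (fun p : Space => ‖f p‖ₑ ^ (2 : ℝ)) :=
    ((Lp.stronglyMeasurable f).measurable.enorm).pow_const _
  have h3 := lintegral_prod_symm (μ := (volume : Measure Plane)) (ν := (volume : Measure ℝ))
    (fun p : Space => ‖f p‖ₑ ^ (2 : ℝ)) h2.aemeasurable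
  rw [← h3]
  simp only [ENNReal.toReal_ofNat] at h1
  exact h1

theorem edist_slice_sq (f : L2 Space) (t : ℝ)
    (h : MemLp (fun x : Plane => f (x, t)) 2 volume) (c : L2 Plane) :
    edist (slice f t) c = (∫⁻ x : Plane, ‖f (x, t) - c x‖ₑ ^ (2 : ℝ)) ^ (1 / 2 : ℝ) := by
  have h1 : slice f t = h.toLp _ := by simp [slice, h]
  rw [h1, Lp.edist_def, eLpNorm_eq_lintegral_rpow_enorm_toReal (by simp) (by simp)]
  simp only [ENNReal.toReal_ofNat]
  congr 1
  refine lintegral_congr_ae ?_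
  filter_upwards [h.coeFn_toLp] with x hx
  simp [hx]

theorem stronglyMeasurable_slice (f : L2 Space) : StronglyMeasurable (slice f) := by
  borelize (L2 Plane)
  have : Fact ((2 : ℝ≥0∞) ≠ ⊤) := ⟨by simp⟩
  have : SecondCountableTopology (L2 Plane) := inferInstance
  refine Measurable.stronglyMeasurable ?_
  have hS : MeasurableSet {t : ℝ | MemLp (fun x : Plane => f (x, t)) 2 volume} := by
    simp_rw [memLp_section_iff]
    have := measurable_lintegral_section f 0 stronglyMeasurable_zero
    simp only [Pi.zero_apply, sub_zero] at this
    exact measurableSet_lt this measurable_const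
  have hd : ∀ c : L2 Plane, Measurable (fun t => edist (slice f t) c) := by
    classical
    intro c
    have : (fun t => edist (slice f t) c) =
        Set.piecewise {t : ℝ | MemLp (fun x : Plane => f (x, t)) 2 volume}
          (fun t => (∫⁻ x : Plane, ‖f (x, t) - c x‖ₑ ^ (2 : ℝ)) ^ (1 / 2 : ℝ))
          (fun _ => edist 0 c) := by
      funext t
      by_cases h : MemLp (fun x : Plane => f (x, t)) 2 volume
      · simpa [Set.piecewise, h] using edist_slice_sq f t h c
      · simp [Set.piecewise, h, slice]
    rw [this]
    exact ((measurable_lintegral_section f c (Lp.stronglyMeasurable c)).pow_const _).piecewise hS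
      measurable_const
  refine measurable_of_isOpen fun U hU => ?_
  choose! r hr0 hr using fun c (hc : c ∈ U) => EMetric.isOpen_iff.1 hU c hc
  obtain ⟨T, hT, hTU⟩ := TopologicalSpace.isOpen_biUnion_countable U
    (fun c => Metric.eball c (r c)) (fun c _ => Metric.isOpen_eball)
  have hU' : U = ⋃ c ∈ T, Metric.eball c (r c) := by
    rw [hTU.2]
    apply Set.Subset.antisymm
    · intro c hc
      exact Set.mem_biUnion hc (Metric.mem_eball_self (hr0 c hc))
    · exact Set.iUnion₂_subset fun c hc => hr c hc
  rw [hU', Set.preimage_iUnion₂]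
  exact MeasurableSet.biUnion hTU.1 fun c _ => measurableSet_lt (hd c) measurable_const

theorem memLp_slice (f : L2 Space) : MemLp (slice f) 2 (volume : Measure ℝ) := by
  refine ⟨(stronglyMeasurable_slice f).aestronglyMeasurable, ?_⟩
  rw [eLpNorm_lt_top_iff_lintegral_rpow_enorm_lt_top (by simp) (by simp)]
  refine lt_of_le_of_lt (lintegral_mono fun t => ?_) (lintegral_sections f)
  by_cases h : MemLp (fun x : Plane => f (x, t)) 2 volume
  · have h1 : slice f t = h.toLp _ := by simp [slice, h]
    rw [h1, Lp.enorm_toLp, eLpNorm_eq_lintegral_rpow_enorm_toReal (by simp) (by simp)]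
    rw [← ENNReal.rpow_mul]
    simp
  · simp [slice, h]

/-- The identification of `L²(ℝ³)` with `L²(ℝ, L²(ℝ²))`, sending `f` to `t ↦ f(·, t)`. -/
def sliceL2 (f : L2 Space) : Lp (L2 Plane) 2 (volume : Measure ℝ) := (memLp_slice f).toLp _

/-- The partial Fourier transform `𝒰 : L²(ℝ³) → L²(ℝ, L²(ℝ²))`,
`(𝒰 f)_k = (2π)^{-1/2} ∫ e^{-ikt} f(·, t) dt`, in the `L²` sense. The Fourier transform `𝓕` of the
library is the unitary one on `L²(ℝ, L²(ℝ²))` with kernel `e^{-2πikt}`, whence the rescaling. -/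
def partialFourier (f : L2 Space) (k : ℝ) : L2 Plane :=
  (((Real.sqrt (2 * Real.pi))⁻¹ : ℝ) : ℂ) •
    (𝓕 (sliceL2 f) : Lp (L2 Plane) 2 (volume : Measure ℝ)) (k / (2 * Real.pi))

/-- `(γ_k)_k` is a family of fibers of `γ`, that is, `𝒰 γ 𝒰⁻¹ = ∫^⊕ γ_k dk`: for all `f`,
`(𝒰 γ f)_k = γ_k (𝒰 f)_k` for almost every `k`. -/
def IsFiberFamily (γ : L2 Space →L[ℂ] L2 Space) (γk : ℝ → L2 Plane →L[ℂ] L2 Plane) : Prop :=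
  ∀ f : L2 Space, ∀ᵐ k : ℝ, partialFourier (γ f) k = γk k (partialFourier f k)

/-- `Λ(γ) = G`, that is, `G = (1 / 2π) ∫ γ_k dk` where `(γ_k)_k` are the fibers of `γ`, the integral
being understood weakly. (The fibers are unique up to a set of `k` of measure zero.) -/
def HasReducedState (γ : L2 Space →L[ℂ] L2 Space) (G : L2 Plane →L[ℂ] L2 Plane) : Prop :=
  ∃ γk : ℝ → L2 Plane →L[ℂ] L2 Plane, IsFiberFamily γ γk ∧
    ∀ u w : L2 Plane, Integrable (fun k => ⟪u, γk k w⟫) ∧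
      ⟪u, G w⟫ = ((1 / (2 * Real.pi) : ℝ) : ℂ) * ∫ k : ℝ, ⟪u, γk k w⟫

/-- `A = ∑ⱼ aⱼ |φⱼ⟩⟨φⱼ|`, with strong convergence of the series. -/
def IsDiagonal {ι : Type} (A : L2 Plane →L[ℂ] L2 Plane) (a : ι → ℝ) (φ : ι → L2 Plane) : Prop :=
  ∀ u : L2 Plane, HasSum (fun j => (a j : ℂ) • ⟪φ j, u⟫ • φ j) (A u)

end

/-! The partial Fourier transform in `x₃` turns `γ` into multiplication by its fibers. With kernel
`e^{-2πiξt}` the frequency is `k = 2πξ`; put `A ξ = γk (2πξ)`. Then `Λ(γ) = G` reads `∫ A ξ dξ = G`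
weakly, `0 ≤ γ ≤ 1` becomes `0 ≤ A ξ ≤ 1` for almost every `ξ`, and the kinetic energy splits into a
transverse part, which depends on `γ` through `G` alone, and the longitudinal part `∫ (2πξ)² Tr(A ξ)
dξ`. If `G = ∑ gⱼ |φⱼ⟩⟨φⱼ|`, then `q(ξ) = ⟨φⱼ, A ξ φⱼ⟩` lies between 0 and 1 and has integral `gⱼ`.
By the bathtub principle its second moment is least when `q` is the indicator of `|ξ| < gⱼ/2`, with
value `(π²/3) gⱼ³`. Summing over `j` and halving gives `(π²/6) Tr(G³)`, and filling each mode
exactly this way gives the minimizer.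

Kinetic traces are suprema over orthonormal families of test functions, so the two inequalities use
different tools.

Lower bound (`kineticTrace_ge_of_fibers`): the trace over the slab is tested on products `u_a(x)
v_b(t)` of complete orthonormal families of test functions on the plane and on `(0,1)`. Parseval for
the plane wave cut off to `(0,1)` gives `∑_b |𝓕 v_b(ξ)|² = 1` (`tsum_enorm_fourier_sq`), so the sum
over `b` produces exactly the integrals over `ξ` above; `bathtub` then applies.

Upper bound (`kineticEnergy_optimalState_le`): for any orthonormal test family in the slab, the
component along `φⱼ` of a fiber is the inner product with `φⱼ ⊗ wave`. Integration by parts moves a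
transverse derivative onto `φⱼ` and turns the longitudinal one into the factor `2πiξ`. Bessel's
inequality at each frequency bounds the sum over the family, and integration over `|ξ| < gⱼ/2` gives
the claimed value. The weak derivatives of `φⱼ` exist when `Tr(-Δ₂ G)` is finite and `gⱼ > 0`; if
that trace is infinite the bound is trivial. -/

noncomputable section

/-! ### Bessel, Parseval and traces in a Hilbert space. -/

section Hilbert

variable {H : Type} [NormedAddCommGroup H] [InnerProductSpace ℂ H] {ι : Type}

theorem ofReal_norm_sq {E : Type*} [SeminormedAddGroup E] (x : E) :
    ENNReal.ofReal (‖x‖ ^ 2) = ‖x‖ₑ ^ 2 := by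
  rw [ENNReal.ofReal_pow (norm_nonneg x), ofReal_norm]

theorem Orthonormal.tsum_enorm_inner_sq_le {e : ι → H} (he : Orthonormal ℂ e) (x : H) :
    ∑' i, ‖⟪e i, x⟫‖ₑ ^ 2 ≤ ‖x‖ₑ ^ 2 := by
  simp_rw [← ofReal_norm_sq]
  rw [← ENNReal.ofReal_tsum_of_nonneg (fun _ => by positivity) (he.inner_products_summable x)]
  exact ENNReal.ofReal_le_ofReal (he.tsum_inner_products_le x)

/-- Bessel gives summability. The sum lies in the closed span and has the same coefficients as `x`,
so the difference is orthogonal to every `e j`. -/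
theorem Orthonormal.hasSum_starProjection [CompleteSpace H] {e : ι → H} (he : Orthonormal ℂ e)
    (x : H) :
    HasSum (fun i => ⟪e i, x⟫ • e i)
      ((Submodule.span ℂ (Set.range e)).topologicalClosure.starProjection x) := by
  set K := (Submodule.span ℂ (Set.range e)).topologicalClosure with hK
  have heK : ∀ i, e i ∈ K := fun i =>
    Submodule.le_topologicalClosure _ (Submodule.subset_span ⟨i, rfl⟩)
  have hs : Summable (fun i => ⟪e i, x⟫ • e i) := by
    have := (he.orthogonalFamily.summable_iff_norm_sq_summable (fun i => ⟪e i, x⟫)).2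
      (he.inner_products_summable x)
    simpa using! this
  have hy : ∑' i, ⟪e i, x⟫ • e i ∈ K :=
    (Submodule.isClosed_topologicalClosure _).mem_of_tendsto hs.hasSum
      (Filter.Eventually.of_forall fun s => K.sum_mem fun i _ => K.smul_mem _ (heK i))
  have hin : ∀ j, ⟪e j, ∑' i, ⟪e i, x⟫ • e i⟫ = ⟪e j, x⟫ := by
    classical
    intro j
    rw [← innerSL_apply_apply ℂ, (innerSL ℂ (e j)).map_tsum hs, tsum_eq_single j]
    · simp [he.1 j]
    · intro i hi
      simp [he.2 hi.symm]
  have : K.starProjection x = ∑' i, ⟪e i, x⟫ • e i := by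
    refine Submodule.eq_starProjection_of_mem_orthogonal hy ?_
    rw [hK, Submodule.orthogonal_closure, Submodule.mem_orthogonal]
    intro u hu
    induction hu using Submodule.span_induction with
    | mem u hu =>
      obtain ⟨j, rfl⟩ := hu
      rw [inner_sub_right, hin, sub_self]
    | zero => simp
    | add u v _ _ hu hv => rw [inner_add_left, hu, hv, add_zero]
    | smul c u _ hu => rw [inner_smul_left, hu, mul_zero]
  rw [this]
  exact hs.hasSum

/-- The family need not be complete in `H`: this form serves plane waves cut off to `(0,1)`,
expanded in test functions on that interval inside `L²(ℝ)`. -/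
theorem Orthonormal.tsum_enorm_inner_sq [CompleteSpace H] {e : ι → H} (he : Orthonormal ℂ e) {x : H}
    (hx : x ∈ (Submodule.span ℂ (Set.range e)).topologicalClosure) :
    ∑' i, ‖⟪e i, x⟫‖ₑ ^ 2 = ‖x‖ₑ ^ 2 := by
  have h1 := he.hasSum_starProjection x
  rw [Submodule.starProjection_eq_self_iff.2 hx] at h1
  have h2 : HasSum (fun i => ‖⟪e i, x⟫‖ ^ 2) (‖x‖ ^ 2) := by
    have h3 := (h1.mapL (innerSL ℂ x)).mapL Complex.reCLM
    have h4 : Complex.reCLM (innerSL ℂ x x) = ‖x‖ ^ 2 := by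
      simp [inner_self_eq_norm_sq_to_K, ← Complex.ofReal_pow]
    rw [h4] at h3
    refine h3.congr_fun fun i => ?_
    simp only [innerSL_apply_apply, inner_smul_right, Complex.reCLM_apply]
    rw [← inner_conj_symm x (e i), RCLike.mul_conj]
    simp [← Complex.ofReal_pow]
  simp_rw [← ofReal_norm_sq]
  rw [← ENNReal.ofReal_tsum_of_nonneg (fun _ => by positivity) h2.summable, h2.tsum_eq]

/-- Distinct members are at distance `√2`, so balls of radius `1/2` are disjoint. Countability is
what later permits exchanging sums and integrals. -/
theorem Orthonormal.countable [TopologicalSpace.SeparableSpace H] {e : ι → H}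
    (he : Orthonormal ℂ e) : Countable ι := by
  refine Pairwise.countable_of_isOpen_disjoint (s := fun i => Metric.ball (e i) (1 / 2)) ?_
    (fun _ => Metric.isOpen_ball) (fun _ => ⟨_, Metric.mem_ball_self (by norm_num)⟩)
  intro i j hij
  refine Metric.ball_disjoint_ball ?_
  have h : ‖e i - e j‖ ^ 2 = 2 := by
    rw [@norm_sub_sq ℂ, he.2 hij, he.1, he.1]; norm_num
  rw [dist_eq_norm]
  nlinarith [norm_nonneg (e i - e j)]

open InnerProductSpace in
/-- Gram-Schmidt orthogonalization does not change an initial orthonormal segment. -/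
theorem gramSchmidt_eq_of_orthonormal_initial (f : ℕ → H) (n : ℕ)
    (hf : ∀ i < n, ∀ j < i, ⟪f j, f i⟫ = 0) (i : ℕ) (hi : i < n) : gramSchmidt ℂ f i = f i := by
  induction i using Nat.strong_induction_on with
  | _ i ih =>
    rw [gramSchmidt_def, Finset.sum_eq_zero, sub_zero]
    intro j hj
    rw [Finset.mem_Iio] at hj
    rw [ih j hj (hj.trans hi), Submodule.starProjection_singleton, hf i hi j hj]
    simp

open InnerProductSpace in
/-- A finite orthonormal family in a subspace `D` of a separable Hilbert space extends to an
orthonormal family in `D` whose closed span contains `D`. -/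
theorem exists_orthonormal_extension [TopologicalSpace.SeparableSpace H]
    (D : Submodule ℂ H) {n : ℕ} {e : Fin n → H} (he : Orthonormal ℂ e) (heD : ∀ i, e i ∈ D) :
    ∃ (κ : Type) (ε : κ → H) (f : Fin n → κ), Orthonormal ℂ ε ∧ (∀ a, ε a ∈ D) ∧
      Function.Injective f ∧ (∀ i, ε (f i) = e i) ∧
      D ≤ (Submodule.span ℂ (Set.range ε)).topologicalClosure := by
  obtain ⟨T, hTD, hTc, hT⟩ :=
    (TopologicalSpace.IsSeparable.of_separableSpace (D : Set H)).exists_countable_dense_subset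
  have hTne : T.Nonempty := by
    rw [← closure_nonempty_iff]
    exact ⟨0, hT D.zero_mem⟩
  obtain ⟨ψ, rfl⟩ := hTc.exists_eq_range hTne
  -- The given family comes first, followed by a dense sequence of `D`: Gram–Schmidt leaves the
  -- initial segment unchanged and preserves the span.
  set F : ℕ → H := fun i => if h : i < n then e ⟨i, h⟩ else ψ (i - n) with hF
  have hFD : ∀ i, F i ∈ D := by
    intro i
    by_cases h : i < n
    · simpa [hF, h] using heD ⟨i, h⟩
    · simpa [hF, h] using hTD ⟨i - n, rfl⟩
  have hgs : ∀ i : Fin n, gramSchmidtNormed ℂ F i = e i := by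
    intro i
    have h1 : gramSchmidt ℂ F i = e i := by
      rw [gramSchmidt_eq_of_orthonormal_initial F n _ i i.2]
      · simp [hF]
      · intro i hi j hj
        have hj' := hj.trans hi
        simp only [hF, hi, hj', dif_pos]
        exact he.2 (by simp [Fin.ext_iff, hj.ne])
    rw [gramSchmidtNormed, h1, he.1 i]
    simp
  have hspan : Submodule.span ℂ (Set.range (gramSchmidtNormed ℂ F)) =
      Submodule.span ℂ (Set.range F) := by
    rw [span_gramSchmidtNormed_range, span_gramSchmidt]
  -- Gram–Schmidt returns zero at vectors dependent on their predecessors; these indices are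
  -- dropped.
  refine ⟨{i | gramSchmidtNormed ℂ F i ≠ 0}, fun i => gramSchmidtNormed ℂ F i,
    fun i => ⟨i, ?_⟩, gramSchmidtNormed_orthonormal' F, fun a => ?_, ?_, hgs, ?_⟩
  · rw [Set.mem_ofPred_eq, hgs]
    exact he.ne_zero i
  · have h1 : gramSchmidtNormed ℂ F a ∈ Submodule.span ℂ (Set.range F) := by
      rw [← hspan]
      exact Submodule.subset_span ⟨_, rfl⟩
    refine (Submodule.span_le.2 ?_) h1
    rintro _ ⟨i, rfl⟩
    exact hFD i
  · intro i j h
    simpa [Fin.ext_iff] using h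
  · have h1 : Submodule.span ℂ (Set.range F) ≤ Submodule.span ℂ (Set.range
        (fun i : {i | gramSchmidtNormed ℂ F i ≠ 0} => gramSchmidtNormed ℂ F i)) := by
      rw [← hspan, Submodule.span_le]
      rintro _ ⟨i, rfl⟩
      by_cases h : gramSchmidtNormed ℂ F i = 0
      · rw [h]; exact Submodule.zero_mem _
      · exact Submodule.subset_span ⟨⟨i, h⟩, rfl⟩
    intro x hx
    refine closure_mono ?_ (hT hx)
    rintro _ ⟨i, rfl⟩
    refine h1 (Submodule.subset_span ⟨i + n, ?_⟩)
    simp [hF]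

/-- With `B = √A` the quadratic form becomes a squared norm, to which Parseval applies. -/
theorem ContinuousLinearMap.exists_norm_sq_eq_inner [CompleteSpace H] {A : H →L[ℂ] H} (hA : 0 ≤ A) :
    ∃ B : H →L[ℂ] H, (∀ x y, ⟪B x, y⟫ = ⟪x, B y⟫) ∧
      ∀ x, ENNReal.ofReal (RCLike.re ⟪x, A x⟫) = ‖B x‖ₑ ^ 2 := by
  have hB : 0 ≤ CFC.sqrt A := CFC.sqrt_nonneg A
  have hsym := ((ContinuousLinearMap.nonneg_iff_isPositive _).1 hB).inner_left_eq_inner_right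
  refine ⟨CFC.sqrt A, hsym, fun x => ?_⟩
  rw [← ofReal_norm_sq]
  conv_lhs => rw [← CFC.sqrt_mul_sqrt_self A hA]
  rw [mul_apply_eq_comp, ← hsym, inner_self_eq_norm_sq]

/-- The double sum of `|⟨ε a, B φ i⟩|²` is read in both orders: Parseval for the complete family
`ε`, Bessel for `φ`. -/
theorem tsum_inner_le_of_complete [CompleteSpace H] {κ : Type} {A : H →L[ℂ] H} (hA : 0 ≤ A)
    {ε : κ → H} (hε : Orthonormal ℂ ε)
    (hε' : (Submodule.span ℂ (Set.range ε)).topologicalClosure = ⊤) {φ : ι → H}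
    (hφ : Orthonormal ℂ φ) :
    ∑' i, ENNReal.ofReal (RCLike.re ⟪φ i, A (φ i)⟫) ≤
      ∑' a, ENNReal.ofReal (RCLike.re ⟪ε a, A (ε a)⟫) := by
  obtain ⟨B, hB, hBA⟩ := ContinuousLinearMap.exists_norm_sq_eq_inner hA
  simp_rw [hBA]
  calc ∑' i, ‖B (φ i)‖ₑ ^ 2 = ∑' i, ∑' a, ‖⟪ε a, B (φ i)⟫‖ₑ ^ 2 := by
        congr 1 with i
        rw [hε.tsum_enorm_inner_sq (hε' ▸ Submodule.mem_top)]
    _ = ∑' a, ∑' i, ‖⟪φ i, B (ε a)⟫‖ₑ ^ 2 := by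
        rw [ENNReal.tsum_comm]
        congr 1 with a
        congr 1 with i
        rw [← hB, ← inner_conj_symm, RCLike.enorm_conj]
    _ ≤ _ := ENNReal.tsum_le_tsum fun a => hφ.tsum_enorm_inner_sq_le _

theorem posTrace_eq_tsum_of_complete [CompleteSpace H] {κ : Type} {A : H →L[ℂ] H} (hA : 0 ≤ A)
    {ε : κ → H} (hε : Orthonormal ℂ ε)
    (hε' : (Submodule.span ℂ (Set.range ε)).topologicalClosure = ⊤) :
    posTrace A = ∑' a, ENNReal.ofReal (RCLike.re ⟪ε a, A (ε a)⟫) := by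
  refine le_antisymm ?_ ?_
  · refine iSup_le fun n => iSup_le fun e => iSup_le fun he => iSup_le fun _ => ?_
    rw [← tsum_fintype (L := .unconditional _)]
    exact tsum_inner_le_of_complete hA hε hε' he
  · rw [ENNReal.tsum_eq_iSup_sum]
    refine iSup_le fun s => ?_
    refine le_trans ?_ (le_iSup_of_le s.card (le_iSup_of_le (fun i => ε (s.equivFin.symm i))
      (le_iSup_of_le (hε.comp _ ?_) (le_iSup_of_le (fun _ => Set.mem_univ _) le_rfl))))
    · rw [Equiv.sum_comp s.equivFin.symm
        (fun a : s => ENNReal.ofReal (RCLike.re ⟪ε a, A (ε a)⟫)), Finset.sum_coe_sort s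
        (fun a => ENNReal.ofReal (RCLike.re ⟪ε a, A (ε a)⟫))]
    · exact Subtype.val_injective.comp s.equivFin.symm.injective

end Hilbert

/-! ### Spectral decomposition of positive trace class operators. -/

section Spectral

variable {H : Type} [NormedAddCommGroup H] [InnerProductSpace ℂ H] [CompleteSpace H]

theorem ContinuousLinearMap.norm_sq_apply_le_of_nonneg {A : H →L[ℂ] H} (hA : 0 ≤ A) (x : H) :
    ‖A x‖ ^ 2 ≤ ‖CFC.sqrt A‖ ^ 2 * RCLike.re ⟪x, A x⟫ := by
  have hB : 0 ≤ CFC.sqrt A := CFC.sqrt_nonneg A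
  have hsym := ((ContinuousLinearMap.nonneg_iff_isPositive _).1 hB).inner_left_eq_inner_right
  have h1 : A x = CFC.sqrt A (CFC.sqrt A x) := by
    conv_lhs => rw [← CFC.sqrt_mul_sqrt_self A hA]
    rfl
  rw [h1, ← hsym, inner_self_eq_norm_sq, ← mul_pow]
  gcongr
  exact ContinuousLinearMap.le_opNorm _ _

/-- Finite trace makes `∑ ‖A b_a‖²` finite, so `A` is Hilbert–Schmidt and is the norm limit of its
finite rank truncations along the basis. -/
theorem posTrace_compact {A : H →L[ℂ] H} (hA : 0 ≤ A) (htr : posTrace A < ⊤) :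
    IsCompactOperator A := by
  obtain ⟨w, b, hb⟩ := exists_hilbertBasis ℂ H
  have hε := b.orthonormal
  have htop := b.dense_span
  have hsum : Summable fun a => ‖A (b a)‖ ^ 2 := by
    have h1 : Summable fun a => RCLike.re ⟪b a, A (b a)⟫ := by
      rw [posTrace_eq_tsum_of_complete hA hε htop] at htr
      have := ENNReal.summable_toReal htr.ne
      refine this.congr fun a => ?_
      rw [ENNReal.toReal_ofReal]
      exact ((ContinuousLinearMap.nonneg_iff_isPositive _).1 hA).re_inner_nonneg_right _
    exact Summable.of_nonneg_of_le (fun _ => by positivity)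
      (fun a => ContinuousLinearMap.norm_sq_apply_le_of_nonneg hA (b a)) (h1.mul_left _)
  set F : Finset w → H →L[ℂ] H := fun s => ∑ a ∈ s, (innerSL ℂ (b a)).smulRight (A (b a)) with hF
  have hFx : ∀ x, Filter.Tendsto (fun s => F s x) Filter.atTop (nhds (A x)) := by
    intro x
    have h1 := (b.hasSum_repr x).mapL A
    have h2 : (fun s => F s x) = fun s : Finset w => ∑ a ∈ s, A (b.repr x a • b a) := by
      funext s
      simp [hF, b.repr_apply_apply]
    rw [h2]
    exact h1
  refine isCompactOperator_of_tendsto (F := F) (l := Filter.atTop) ?_ ?_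
  · have hC : CauchySeq F := by
      rw [cauchySeq_finset_iff_vanishing_norm]
      intro ε hε0
      -- By Cauchy–Schwarz a tail of `∑ ‖A b_a‖²` below `ε²/4` yields operator norm at most `ε/2`.
      obtain ⟨s, hs⟩ := summable_iff_vanishing_norm.1 hsum (ε ^ 2 / 4) (by positivity)
      refine ⟨s, fun t ht => ?_⟩
      have h1 := hs t ht
      rw [Real.norm_of_nonneg (Finset.sum_nonneg fun _ _ => by positivity)] at h1
      refine lt_of_le_of_lt (ContinuousLinearMap.opNorm_le_bound _ (by positivity : 0 ≤ ε / 2)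
        fun x => ?_) (half_lt_self hε0)
      have h3 : ‖(∑ a ∈ t, (innerSL ℂ (b a)).smulRight (A (b a))) x‖ ≤
          ∑ a ∈ t, ‖⟪b a, x⟫‖ * ‖A (b a)‖ := by
        rw [sum_apply]
        refine (norm_sum_le _ _).trans (Finset.sum_le_sum fun a _ => ?_)
        simp [norm_smul]
      refine h3.trans (le_of_sq_le_sq ?_ (by positivity))
      refine (Finset.sum_mul_sq_le_sq_mul_sq _ _ _).trans ?_
      have h4 : ∑ a ∈ t, ‖⟪b a, x⟫‖ ^ 2 ≤ ‖x‖ ^ 2 := b.orthonormal.sum_inner_products_le x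
      calc _ ≤ ‖x‖ ^ 2 * (ε ^ 2 / 4) := by gcongr
        _ = _ := by ring
    obtain ⟨T, hT⟩ := cauchySeq_tendsto_of_complete hC
    -- The norm limit is identified through the strong convergence of the truncations to `A`.
    have : T = A := by
      ext x
      exact tendsto_nhds_unique (((ContinuousLinearMap.apply ℂ H x).continuous.tendsto T).comp hT)
        (hFx x)
    exact this ▸ hT
  · refine Filter.Eventually.of_forall fun s => ?_
    have : ∀ s : Finset w, IsCompactOperator (F s) := by
      classical
      intro s
      induction s using Finset.induction_on with
      | empty => simpa [hF] using isCompactOperator_zero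
      | insert a s ha ih =>
        simp only [hF] at ih ⊢
        rw [Finset.sum_insert ha, FunLike.coe_add]
        refine IsCompactOperator.add ?_ ih
        have h1 : IsCompactOperator (ContinuousLinearMap.toSpanSingleton ℂ (A (b a))) :=
          (isCompactOperator_id_iff_locallyCompactSpace.2 inferInstance).clm_comp _
        exact h1.comp_clm (innerSL ℂ (b a))
    exact this s

open scoped ComplexOrder in
/-- The spectral theorem for positive trace class operators. -/
theorem exists_eigenbasis {A : H →L[ℂ] H} (hA : 0 ≤ A) (hc : IsCompactOperator A) :
    ∃ (κ : Type) (b : HilbertBasis κ ℂ H) (a : κ → ℝ), ∀ i, 0 ≤ a i ∧ A (b i) = (a i : ℂ) • b i := by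
  have hpos := (ContinuousLinearMap.nonneg_iff_isPositive _).1 hA
  have hsym : (A : H →ₗ[ℂ] H).IsSymmetric := hpos.isSymmetric
  have hfam := hsym.orthogonalFamily_eigenspaces
  have hcl : ∀ μ : ℂ, IsClosed (Module.End.eigenspace (A : H →ₗ[ℂ] H) μ : Set H) := by
    intro μ
    have : (Module.End.eigenspace (A : H →ₗ[ℂ] H) μ : Set H) = {x | A x = μ • x} := by
      ext x; simp
    rw [this]
    exact isClosed_eq A.continuous (continuous_const_smul μ)
  have : ∀ μ : ℂ, CompleteSpace (Module.End.eigenspace (A : H →ₗ[ℂ] H) μ) := fun μ =>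
    (hcl μ).completeSpace_coe
  choose w v hv using fun μ : ℂ => exists_hilbertBasis ℂ (Module.End.eigenspace (A : H →ₗ[ℂ] H) μ)
  have hon := hfam.orthonormal_sigma_orthonormal (fun μ => (v μ).orthonormal)
  have hdense : ⊤ ≤ (Submodule.span ℂ (Set.range fun a : Σ μ, w μ =>
      ((v a.1 a.2 : Module.End.eigenspace (A : H →ₗ[ℂ] H) a.1) : H))).topologicalClosure := by
    have h1 := ContinuousLinearMap.orthogonalComplement_iSup_eigenspaces_eq_bot hc hsym
    rw [top_le_iff, Submodule.topologicalClosure_eq_top_iff, eq_bot_iff, ← h1]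
    intro x hx
    rw [Submodule.mem_orthogonal] at hx ⊢
    intro u hu
    induction hu using Submodule.iSup_induction' with
    | mem μ u hu =>
      have h2 := ((v μ).hasSum_repr ⟨u, hu⟩).mapL
        ((innerSL ℂ x) ∘L (Module.End.eigenspace (A : H →ₗ[ℂ] H) μ).subtypeL)
      have h3 : (fun i => ((innerSL ℂ x) ∘L (Module.End.eigenspace (A : H →ₗ[ℂ] H) μ).subtypeL)
          ((v μ).repr ⟨u, hu⟩ i • (v μ) i)) = 0 := by
        funext i
        have h4 := hx (v μ i) (Submodule.subset_span ⟨⟨μ, i⟩, rfl⟩)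
        rw [← inner_conj_symm, starRingEnd_apply, star_eq_zero] at h4
        simp [h4]
      rw [h3] at h2
      have h5 := h2.unique hasSum_zero
      simp only [ContinuousLinearMap.comp_apply, Submodule.subtypeL_apply,
        innerSL_apply_apply] at h5
      rw [← inner_conj_symm, h5, map_zero]
    | zero => simp
    | add u v _ _ hu hv => rw [inner_add_left, hu, hv, add_zero]
  let B : HilbertBasis (Σ μ, w μ) ℂ H := HilbertBasis.mk hon hdense
  have hB : ∀ i, B i = (v i.1 i.2 : H) := fun i => congrFun (HilbertBasis.coe_mk hon hdense) i
  have hAB : ∀ i, A (B i) = i.1 • B i := by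
    intro i
    rw [hB]
    exact Module.End.mem_eigenspace_iff.1 (v i.1 i.2).2
  -- The basis is assembled from the eigenspaces of all complex `μ`; positivity shows that only
  -- nonnegative real `μ` contribute basis vectors.
  have hre : ∀ i : Σ μ, w μ, (0 : ℂ) ≤ i.1 := by
    intro i
    have h := hpos.inner_nonneg_right (B i)
    rw [hAB, inner_smul_right, inner_self_eq_norm_sq_to_K, B.orthonormal.1] at h
    simpa using h
  refine ⟨_, B, fun i => i.1.re, fun i => ⟨(Complex.le_def.1 (hre i)).1, ?_⟩⟩
  rw [hAB]
  congr 1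
  exact Complex.ext (by simp) (by simpa using (Complex.le_def.1 (hre i)).2.symm)

end Spectral

/-! ### Operators diagonal in an orthonormal family. -/

section Diagonal

variable {ι : Type} {A : L2 Plane →L[ℂ] L2 Plane} {a : ι → ℝ} {φ : ι → L2 Plane}

theorem IsDiagonal.apply_self (h : IsDiagonal A a φ) (hφ : Orthonormal ℂ φ) (j : ι) :
    A (φ j) = (a j : ℂ) • φ j := by
  classical
  refine (h (φ j)).unique ?_
  convert hasSum_single j ?_ using 2
  · simp [hφ.1 j]
  · intro i hi
    simp [hφ.2 hi]

theorem IsDiagonal.hasSum_inner (h : IsDiagonal A a φ) (u w : L2 Plane) :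
    HasSum (fun j => (a j : ℂ) * (⟪u, φ j⟫ * ⟪φ j, w⟫)) ⟪u, A w⟫ := by
  refine ((h w).mapL (innerSL ℂ u)).congr_fun fun j => ?_
  simp only [innerSL_apply_apply, inner_smul_right]
  ring

theorem IsDiagonal.ofReal_inner (h : IsDiagonal A a φ) (ha : ∀ j, 0 ≤ a j) (u : L2 Plane) :
    ENNReal.ofReal (RCLike.re ⟪u, A u⟫) = ∑' j, ENNReal.ofReal (a j) * ‖⟪φ j, u⟫‖ₑ ^ 2 := by
  have h1 : HasSum (fun j => a j * ‖⟪φ j, u⟫‖ ^ 2) (RCLike.re ⟪u, A u⟫) := by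
    refine ((h.hasSum_inner u u).mapL Complex.reCLM).congr_fun fun j => ?_
    rw [← inner_conj_symm u (φ j), RCLike.conj_mul]
    simp [← Complex.ofReal_pow, ← Complex.ofReal_mul]
  rw [← h1.tsum_eq, ENNReal.ofReal_tsum_of_nonneg (fun j => by have := ha j; positivity) h1.summable]
  congr 1 with j
  rw [ENNReal.ofReal_mul (ha j), ofReal_norm_sq]

/-- The family `φ` itself reaches the value, and Bessel applied to each `φ j` shows that no other
family exceeds it. Completeness of `φ` is not needed. -/
theorem IsDiagonal.posTrace_eq (h : IsDiagonal A a φ) (ha : ∀ j, 0 ≤ a j) (hφ : Orthonormal ℂ φ) :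
    posTrace A = ∑' j, ENNReal.ofReal (a j) := by
  refine le_antisymm ?_ ?_
  · refine iSup_le fun n => iSup_le fun e => iSup_le fun he => iSup_le fun _ => ?_
    simp_rw [h.ofReal_inner ha]
    rw [← tsum_fintype (L := .unconditional _), ENNReal.tsum_comm]
    refine ENNReal.tsum_le_tsum fun j => ?_
    rw [ENNReal.tsum_mul_left]
    calc _ ≤ ENNReal.ofReal (a j) * ‖φ j‖ₑ ^ 2 := by
          gcongr
          refine le_trans (le_of_eq ?_) (he.tsum_enorm_inner_sq_le (φ j))
          congr 1 with i
          rw [← inner_conj_symm, RCLike.enorm_conj]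
      _ = _ := by rw [← ofReal_norm_sq, hφ.1 j]; simp
  · rw [ENNReal.tsum_eq_iSup_sum]
    refine iSup_le fun s => ?_
    refine le_trans (le_of_eq ?_) (le_iSup_of_le s.card
      (le_iSup_of_le (fun i => φ (s.equivFin.symm i)) (le_iSup_of_le
        (hφ.comp _ (Subtype.val_injective.comp s.equivFin.symm.injective))
        (le_iSup_of_le (fun _ => Set.mem_univ _) le_rfl))))
    rw [Equiv.sum_comp s.equivFin.symm
        (fun j : s => ENNReal.ofReal (RCLike.re ⟪φ j, A (φ j)⟫)), Finset.sum_coe_sort s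
        (fun j => ENNReal.ofReal (RCLike.re ⟪φ j, A (φ j)⟫))]
    refine Finset.sum_congr rfl fun j _ => ?_
    rw [h.apply_self hφ, inner_smul_right, inner_self_eq_norm_sq_to_K, hφ.1]
    simp

theorem IsDiagonal.pow_three (h : IsDiagonal A a φ) (hφ : Orthonormal ℂ φ) :
    IsDiagonal (A ^ 3) (fun j => a j ^ 3) φ := by
  intro u
  refine ((h u).mapL (A ^ 2)).congr_fun fun j => ?_
  rw [map_smul, map_smul, pow_two, mul_apply_eq_comp, h.apply_self hφ, map_smul,
    h.apply_self hφ, smul_comm (⟪φ j, u⟫)]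
  simp only [smul_smul]
  congr 1
  push_cast
  ring

/-- Indicators of disjoint balls centred at integer points of an axis are independent. This makes
every orthonormal basis infinite, so that an eigenbasis, including the kernel of `G`, can be indexed
by `ℕ`. -/
theorem not_finiteDimensional_L2_plane : ¬ FiniteDimensional ℂ (L2 Plane) := by
  intro hfin
  set c : ℕ → Plane := fun n => EuclideanSpace.single 0 (n : ℝ) with hc
  have hfinite : ∀ n, volume (Metric.ball (c n) (1 / 2)) ≠ ⊤ := fun n => measure_ball_lt_top.ne
  set f : ℕ → L2 Plane := fun n =>
    indicatorConstLp 2 (measurableSet_ball (x := c n) (ε := 1 / 2)) (hfinite n) (1 : ℂ) with hf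
  have hdisj : ∀ n m, n ≠ m → Disjoint (Metric.ball (c n) (1 / 2)) (Metric.ball (c m) (1 / 2)) := by
    intro n m hnm
    refine Metric.ball_disjoint_ball ?_
    rw [hc, dist_eq_norm, ← PiLp.single_sub, PiLp.norm_single]
    norm_num
    have h1 : (1 : ℤ) ≤ |(n : ℤ) - m| := Int.one_le_abs (sub_ne_zero.2 (by exact_mod_cast hnm))
    exact_mod_cast h1
  have hli : LinearIndependent ℂ f := by
    refine linearIndependent_of_ne_zero_of_inner_eq_zero (𝕜 := ℂ) (fun n h0 => ?_) fun n m hnm => ?_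
    · have h1 : ‖f n‖ = 0 := by rw [h0, norm_zero]
      rw [hf, norm_indicatorConstLp (by simp) (by simp)] at h1
      have h2 := Metric.measure_ball_pos volume (c n) (by norm_num : (0 : ℝ) < 1 / 2)
      have h3 : 0 < volume.real (Metric.ball (c n) (1 / 2)) := ENNReal.toReal_pos h2.ne' (hfinite n)
      have h4 := Real.rpow_pos_of_pos h3 (1 / (2 : ℝ≥0∞).toReal)
      simp at h1 h4
      linarith
    · have h1 := L2.inner_indicatorConstLp_indicatorConstLp (𝕜 := ℂ) (μ := volume)
        (measurableSet_ball (x := c n) (ε := 1 / 2)) (measurableSet_ball (x := c m) (ε := 1 / 2))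
        (hfinite n) (hfinite m) (1 : ℂ) (1 : ℂ)
      rw [(hdisj n m hnm).inter_eq] at h1
      exact h1.trans (by simp)
  have := hli.finite
  exact not_finite ℕ

theorem exists_isDiagonal {G : L2 Plane →L[ℂ] L2 Plane} (hG : G ∈ reducedStates) :
    ∃ (g : ℕ → ℝ) (φ : ℕ → L2 Plane),
      Orthonormal ℂ φ ∧ (∀ j, 0 ≤ g j) ∧ IsDiagonal G g φ := by
  obtain ⟨κ, b, a, hab⟩ := exists_eigenbasis hG.1 (posTrace_compact hG.1 hG.2)
  have : Fact ((2 : ℝ≥0∞) ≠ ⊤) := ⟨by simp⟩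
  have hcount : Countable κ := b.orthonormal.countable
  have hκ : Infinite κ := by
    by_contra hfin
    rw [not_infinite_iff_finite] at hfin
    have := Fintype.ofFinite κ
    exact not_finiteDimensional_L2_plane b.toOrthonormalBasis.toBasis.finiteDimensional_of_finite
  obtain ⟨e⟩ := nonempty_equiv_of_countable (α := ℕ) (β := κ)
  refine ⟨fun n => a (e n), fun n => b (e n), b.orthonormal.comp _ e.injective,
    fun n => (hab _).1, fun u => ?_⟩
  have h1 := (b.hasSum_repr u).mapL G
  rw [← e.hasSum_iff] at h1
  refine h1.congr_fun fun n => ?_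
  simp only [Function.comp_apply, map_smul, (hab _).2, b.repr_apply_apply]
  rw [smul_comm]

end Diagonal

/-! ### Fourier transform, multiplication by fibers and translations on `L²(ℝ, H)`. -/

section FourierLp

variable {H : Type} [NormedAddCommGroup H] [InnerProductSpace ℂ H]

/-- For simple `F` the function is a finite sum of indicators times `A ξ c`; the general case is a
pointwise limit by continuity of each `A ξ`. -/
theorem stronglyMeasurable_clm_apply {A : ℝ → H →L[ℂ] H}
    (hA : ∀ u, StronglyMeasurable fun ξ => A ξ u) {F : ℝ → H} (hF : StronglyMeasurable F) :
    StronglyMeasurable fun ξ => A ξ (F ξ) := by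
  refine stronglyMeasurable_of_tendsto Filter.atTop (f := fun n ξ => A ξ (hF.approx n ξ))
    (fun n => ?_) ?_
  · generalize hF.approx n = s
    induction s using SimpleFunc.induction with
    | @const c t ht =>
      convert (hA c).indicator ht using 1
      funext ξ
      by_cases h : ξ ∈ t <;> simp [h]
    | add _ hf hg =>
      convert hf.add hg using 1
      funext ξ
      simp
  · rw [tendsto_pi_nhds]
    exact fun ξ => ((A ξ).continuous.tendsto _).comp (hF.tendsto_approx ξ)

theorem memLp_clm_apply {A : ℝ → H →L[ℂ] H}
    (hA : ∀ u, StronglyMeasurable fun ξ => A ξ u) (h1 : ∀ ξ u, ‖A ξ u‖ ≤ ‖u‖)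
    (F : Lp H 2 (volume : Measure ℝ)) :
    MemLp (fun ξ => A ξ (F ξ)) 2 volume :=
  (Lp.memLp F).mono (stronglyMeasurable_clm_apply hA (Lp.stronglyMeasurable F)).aestronglyMeasurable
    (Filter.Eventually.of_forall fun ξ => h1 ξ _)

/-- The operator on `L²(ℝ, H)` which multiplies by an operator-valued contraction. -/
def fiberMul (A : ℝ → H →L[ℂ] H) (hA : ∀ u, StronglyMeasurable fun ξ => A ξ u)
    (h1 : ∀ ξ u, ‖A ξ u‖ ≤ ‖u‖) :
    Lp H 2 (volume : Measure ℝ) →L[ℂ] Lp H 2 (volume : Measure ℝ) :=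
  LinearMap.mkContinuous
    { toFun := fun F => (memLp_clm_apply hA h1 F).toLp _
      map_add' := fun F G => by
        rw [← MemLp.toLp_add]
        refine MemLp.toLp_congr _ _ ?_
        filter_upwards [Lp.coeFn_add F G] with ξ hξ
        rw [hξ, Pi.add_apply, map_add, Pi.add_apply]
      map_smul' := fun c F => by
        rw [RingHom.id_apply, ← MemLp.toLp_const_smul]
        refine MemLp.toLp_congr _ _ ?_
        filter_upwards [Lp.coeFn_smul c F] with ξ hξ
        rw [hξ, Pi.smul_apply, map_smul, Pi.smul_apply] } 1 fun F => by
    rw [one_mul]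
    refine Lp.norm_le_norm_of_ae_le ?_
    filter_upwards [(memLp_clm_apply hA h1 F).coeFn_toLp] with ξ hξ
    exact (congrArg norm hξ).le.trans (h1 ξ _)

theorem coeFn_fiberMul (A : ℝ → H →L[ℂ] H) (hA : ∀ u, StronglyMeasurable fun ξ => A ξ u)
    (h1 : ∀ ξ u, ‖A ξ u‖ ≤ ‖u‖) (F : Lp H 2 (volume : Measure ℝ)) :
    fiberMul A hA h1 F =ᵐ[volume] fun ξ => A ξ (F ξ) :=
  (memLp_clm_apply hA h1 F).coeFn_toLp

variable [CompleteSpace H]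

omit [CompleteSpace H] in
theorem continuous_fourier_of_integrable {F : ℝ → H} (hF : Integrable F) : Continuous (𝓕 F) :=
  VectorFourier.fourierIntegral_continuous Real.continuous_fourierChar (by fun_prop) hF

/-- On `L¹ ∩ L²` the unitary Fourier transform is given by the Fourier integral. -/
theorem Lp.fourier_ae_eq_of_integrable (F : Lp H 2 (volume : Measure ℝ)) (hF : Integrable F) :
    (𝓕 F : Lp H 2 (volume : Measure ℝ)) =ᵐ[volume] 𝓕 (F : ℝ → H) := by
  refine ae_eq_of_integral_contDiff_smul_eq ((Lp.memLp (𝓕 F)).locallyIntegrable (by norm_num))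
    (continuous_fourier_of_integrable hF).locallyIntegrable fun g hg hgc => ?_
  have hg₁ : HasCompactSupport (Complex.ofRealCLM ∘ g) := hgc.comp_left rfl
  have hg₂ : ContDiff ℝ (⊤ : ℕ∞) (Complex.ofRealCLM ∘ g) := by fun_prop
  set s := hg₁.toSchwartzMap hg₂ with hs
  have h1 := congrArg (fun T => T s) (Lp.fourier_toTemperedDistribution_eq F)
  simp only [TemperedDistribution.fourier_apply, Lp.toTemperedDistribution_apply] at h1
  have h2 : ∀ x, (s x : ℂ) = (g x : ℂ) := fun x => rfl
  have h3 := VectorFourier.integral_fourierIntegral_smul_eq_flip (L := innerₗ ℝ)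
    (μ := volume) (ν := volume) (f := s) (g := F) Real.continuous_fourierChar
    (by fun_prop) s.integrable hF
  calc ∫ x, g x • (𝓕 F : Lp H 2 (volume : Measure ℝ)) x
      = ∫ x, s x • (𝓕 F : Lp H 2 (volume : Measure ℝ)) x := by
        simp_rw [h2, Complex.coe_smul]
    _ = ∫ x, (𝓕 s) x • F x := h1.symm
    _ = ∫ x, s x • 𝓕 (F : ℝ → H) x := by
        rw [SchwartzMap.fourier_coe]
        simpa using! h3
    _ = _ := by simp_rw [h2, Complex.coe_smul]

omit [CompleteSpace H] in
theorem fourier_comp_sub (F : ℝ → H) (R ξ : ℝ) :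
    𝓕 (fun t => F (t - R)) ξ = (Real.fourierChar (-(R * ξ)) : ℂ) • 𝓕 F ξ := by
  rw [Real.fourier_real_eq, Real.fourier_real_eq, ← integral_smul,
    ← integral_sub_right_eq_self (fun t => (Real.fourierChar (-(R * ξ)) : ℂ) •
      (Real.fourierChar (-(t * ξ)) • F t)) R]
  refine integral_congr_ae (Filter.Eventually.of_forall fun t => ?_)
  simp only [Circle.smul_def, smul_smul]
  congr 1
  rw [← Circle.coe_mul, ← AddChar.map_add_eq_mul]
  congr 2
  ring

/-- The translation by `R` on `L²(ℝ, H)`. -/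
def shift (R : ℝ) : Lp H 2 (volume : Measure ℝ) →L[ℂ] Lp H 2 (volume : Measure ℝ) :=
  (Lp.compMeasurePreservingₗᵢ ℂ (fun t : ℝ => t - R)
    (measurePreserving_sub_right volume R)).toContinuousLinearMap

omit [CompleteSpace H] in
theorem coeFn_shift (R : ℝ) (F : Lp H 2 (volume : Measure ℝ)) :
    shift R F =ᵐ[volume] fun t => F (t - R) :=
  Lp.coeFn_compMeasurePreserving F (measurePreserving_sub_right volume R)

/-- The multiplication by `ξ ↦ e^{-2πiRξ}` on `L²(ℝ, H)`. -/
def modulation (R : ℝ) : Lp H 2 (volume : Measure ℝ) →L[ℂ] Lp H 2 (volume : Measure ℝ) :=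
  fiberMul (fun ξ => (Real.fourierChar (-(R * ξ)) : ℂ) • ContinuousLinearMap.id ℂ H)
    (fun u => by
      have : Continuous fun ξ : ℝ => (Real.fourierChar (-(R * ξ)) : ℂ) • u := by
        have := Real.continuous_fourierChar
        fun_prop
      exact this.stronglyMeasurable)
    (fun ξ u => by simp [norm_smul, Circle.norm_coe])

omit [CompleteSpace H] in
theorem coeFn_modulation (R : ℝ) (F : Lp H 2 (volume : Measure ℝ)) :
    modulation R F =ᵐ[volume] fun ξ => (Real.fourierChar (-(R * ξ)) : ℂ) • F ξ :=
  coeFn_fiberMul _ _ _ F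

/-- Both sides are continuous in `F`, and on the dense set of Schwartz functions the transform is an
honest integral, where a change of variable suffices. -/
theorem Lp.fourier_shift (R : ℝ) (F : Lp H 2 (volume : Measure ℝ)) :
    (𝓕 (shift R F) : Lp H 2 (volume : Measure ℝ)) = modulation R (𝓕 F) := by
  have hd : DenseRange (SchwartzMap.toLpCLM ℂ (E := ℝ) H 2 volume) :=
    SchwartzMap.denseRange_toLpCLM (by simp)
  have hc1 : Continuous fun F : Lp H 2 (volume : Measure ℝ) =>
      (𝓕 (shift R F) : Lp H 2 (volume : Measure ℝ)) :=
    (Lp.fourierTransformₗᵢ ℝ H).continuous.comp (shift R).continuous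
  have hc2 : Continuous fun F : Lp H 2 (volume : Measure ℝ) =>
      modulation R (𝓕 F : Lp H 2 (volume : Measure ℝ)) :=
    (modulation R).continuous.comp (Lp.fourierTransformₗᵢ ℝ H).continuous
  refine congrFun (hd.equalizer hc1 hc2 (funext fun f => ?_)) F
  simp only [Function.comp_apply]
  set F := SchwartzMap.toLpCLM ℂ (E := ℝ) H 2 volume f
  have hF : Integrable F := (f.integrable (μ := volume)).congr (f.coeFn_toLp 2 volume).symm
  have hF' : Integrable (shift R F) :=
    (hF.comp_sub_right R).congr (coeFn_shift R F).symm
  refine Lp.ext ?_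
  filter_upwards [Lp.fourier_ae_eq_of_integrable _ hF', Lp.fourier_ae_eq_of_integrable _ hF,
    coeFn_modulation R (𝓕 F : Lp H 2 (volume : Measure ℝ))] with ξ h1 h2 h3
  rw [h1, h3, h2, Real.fourier_congr_ae (coeFn_shift R F), fourier_comp_sub]

end FourierLp

/-! ### The identification of `L²(ℝ³)` with `L²(ℝ, L²(ℝ²))`. -/

section Slices

theorem ae_slice_eq (f : L2 Space) :
    ∀ᵐ t : ℝ, slice f t =ᵐ[volume] fun x => f (x, t) := by
  have h1 : ∀ᵐ t : ℝ, ∫⁻ x : Plane, ‖f (x, t)‖ₑ ^ (2 : ℝ) < ⊤ := by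
    refine ae_lt_top' ?_ (lintegral_sections f).ne
    have := measurable_lintegral_section f 0 stronglyMeasurable_zero
    simp only [Pi.zero_apply, sub_zero] at this
    exact this.aemeasurable
  filter_upwards [h1] with t ht
  have h : MemLp (fun x : Plane => f (x, t)) 2 volume := (memLp_section_iff f t).2 ht
  rw [slice, dif_pos h]
  exact h.coeFn_toLp

theorem ae_ae_swap {p : Space → Prop} (h : ∀ᵐ z : Space, p z) :
    ∀ᵐ t : ℝ, ∀ᵐ x : Plane, p (x, t) := by
  have h1 : ∀ᵐ z : ℝ × Plane, p z.swap :=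
    (Measure.measurePreserving_swap (μ := (volume : Measure ℝ))
      (ν := (volume : Measure Plane))).quasiMeasurePreserving.ae h
  exact Measure.ae_ae_of_ae_prod h1

theorem sliceL2_ae_eq_slice (f : L2 Space) : sliceL2 f =ᵐ[volume] slice f :=
  (memLp_slice f).coeFn_toLp

theorem sliceL2_ae_eq {f : L2 Space} {g : Space → ℂ} (hfg : f =ᵐ[volume] g) {Φ : ℝ → L2 Plane}
    (h : ∀ᵐ t : ℝ, Φ t =ᵐ[volume] fun x => g (x, t)) : sliceL2 f =ᵐ[volume] Φ := by
  filter_upwards [sliceL2_ae_eq_slice f, ae_slice_eq f, h, ae_ae_swap hfg] with t h1 h2 h3 h4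
  rw [h1]
  refine Lp.ext ?_
  filter_upwards [h2, h3, h4] with x h5 h6 h7
  rw [h5, h6, ← h7]

theorem ae_sliceL2_eq (f : L2 Space) :
    ∀ᵐ t : ℝ, sliceL2 f t =ᵐ[volume] fun x => f (x, t) := by
  filter_upwards [sliceL2_ae_eq_slice f, ae_slice_eq f] with t h1 h2
  rw [h1]
  exact h2

theorem enorm_sq_eq_lintegral {X E : Type} [MeasureSpace X] [NormedAddCommGroup E]
    (f : Lp E 2 (volume : Measure X)) :
    ‖f‖ₑ ^ 2 = ∫⁻ x, ‖f x‖ₑ ^ 2 := by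
  rw [Lp.enorm_def, eLpNorm_eq_lintegral_rpow_enorm_toReal (by simp) (by simp)]
  rw [← ENNReal.rpow_natCast, ← ENNReal.rpow_mul]
  simp

theorem enorm_sliceL2 (f : L2 Space) : ‖sliceL2 f‖ₑ = ‖f‖ₑ := by
  have h : ‖sliceL2 f‖ₑ ^ 2 = ‖f‖ₑ ^ 2 := by
    rw [enorm_sq_eq_lintegral, enorm_sq_eq_lintegral]
    have h1 : AEMeasurable (fun z : Space => ‖f z‖ₑ ^ 2) volume :=
      ((Lp.stronglyMeasurable f).measurable.enorm.pow_const _).aemeasurable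
    refine Eq.trans ?_ (lintegral_prod_symm _ h1).symm
    refine lintegral_congr_ae ?_
    filter_upwards [ae_sliceL2_eq f] with t ht
    rw [enorm_sq_eq_lintegral]
    refine lintegral_congr_ae ?_
    filter_upwards [ht] with x hx
    rw [hx]
  exact (ENNReal.pow_right_strictMono two_ne_zero).injective h

/-- The identification of `L²(ℝ³)` with `L²(ℝ, L²(ℝ²))` as a linear isometry. -/
def sliceLI : L2 Space →ₗᵢ[ℂ] Lp (L2 Plane) 2 (volume : Measure ℝ) where
  toFun := sliceL2
  map_add' f g := by
    refine Lp.ext ((sliceL2_ae_eq (Lp.coeFn_add f g) ?_).trans (Lp.coeFn_add _ _).symm)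
    filter_upwards [ae_sliceL2_eq f, ae_sliceL2_eq g] with t h1 h2
    refine (Lp.coeFn_add _ _).trans ?_
    filter_upwards [h1, h2] with x h3 h4
    simp only [Pi.add_apply, h3, h4]
  map_smul' c f := by
    refine Lp.ext ((sliceL2_ae_eq (Lp.coeFn_smul c f) ?_).trans (Lp.coeFn_smul _ _).symm)
    filter_upwards [ae_sliceL2_eq f] with t h1
    refine (Lp.coeFn_smul _ _).trans ?_
    filter_upwards [h1] with x h3
    simp only [Pi.smul_apply, h3, RingHom.id_apply]
  norm_map' f := by
    have := congrArg ENNReal.toReal (enorm_sliceL2 f)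
    simpa using! this

theorem memLp_tensor (w : L2 Plane) (v : L2 ℝ) :
    MemLp (fun p : Space => v p.2 * w p.1) 2 volume := by
  have hm : AEStronglyMeasurable (fun p : Space => v p.2 * w p.1) volume :=
    ((Lp.stronglyMeasurable v).comp_measurable measurable_snd).mul
      ((Lp.stronglyMeasurable w).comp_measurable measurable_fst) |>.aestronglyMeasurable
  refine ⟨hm, ?_⟩
  rw [eLpNorm_lt_top_iff_lintegral_rpow_enorm_lt_top (by simp) (by simp)]
  have h1 : ∀ p : Space, ‖v p.2 * w p.1‖ₑ ^ (2 : ℝ≥0∞).toReal =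
      ‖w p.1‖ₑ ^ 2 * ‖v p.2‖ₑ ^ 2 := by
    intro p
    rw [enorm_mul, mul_comm]
    simp [mul_pow]
  simp_rw [h1]
  rw [Measure.volume_eq_prod, lintegral_prod_mul
    ((Lp.stronglyMeasurable w).measurable.enorm.pow_const _).aemeasurable
    ((Lp.stronglyMeasurable v).measurable.enorm.pow_const _).aemeasurable,
    ← enorm_sq_eq_lintegral, ← enorm_sq_eq_lintegral]
  exact ENNReal.mul_lt_top (by simp) (by simp)

/-- The function `(x, t) ↦ w(x) v(t)`. -/
def tensor (w : L2 Plane) (v : L2 ℝ) : L2 Space := (memLp_tensor w v).toLp _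

theorem sliceL2_tensor (w : L2 Plane) (v : L2 ℝ) :
    sliceL2 (tensor w v) =ᵐ[volume] fun t => v t • w := by
  refine sliceL2_ae_eq (memLp_tensor w v).coeFn_toLp (Filter.Eventually.of_forall fun t => ?_)
  filter_upwards [Lp.coeFn_smul (v t) w] with x hx
  rw [hx]
  simp

/-- The range of an isometry is closed, and it contains the vector-valued indicators, which are
slices of tensors. -/
theorem sliceLI_surjective : Function.Surjective sliceLI := by
  have hcl : IsClosed (Set.range sliceLI) := sliceLI.isometry.isClosedEmbedding.isClosed_range
  intro F
  change F ∈ Set.range sliceLI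
  refine Lp.induction (p := 2) (by simp) (motive := fun F => F ∈ Set.range sliceLI) ?_ ?_ hcl F
  · intro c s hs hμs
    refine ⟨tensor c (indicatorConstLp 2 hs hμs.ne 1), Lp.ext ?_⟩
    refine (sliceL2_tensor _ _).trans ?_
    rw [Lp.simpleFunc.coe_indicatorConst]
    filter_upwards [indicatorConstLp_coeFn (p := 2) (hs := hs) (hμs := hμs.ne) (c := (1 : ℂ)),
      indicatorConstLp_coeFn (p := 2) (hs := hs) (hμs := hμs.ne) (c := c)] with t h1 h2
    rw [h1, h2]
    by_cases h : t ∈ s <;> simp [h]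
  · rintro f g hf hg - ⟨f', hf'⟩ ⟨g', hg'⟩
    exact ⟨f' + g', by rw [map_add, hf', hg']⟩

/-- The unitary operator from `L²(ℝ³)` to `L²(ℝ, L²(ℝ²))` given by the Fourier transform in the
last variable, with kernel `e^{-2πiξt}`. -/
def fiberEquiv : L2 Space ≃ₗᵢ[ℂ] Lp (L2 Plane) 2 (volume : Measure ℝ) :=
  (LinearIsometryEquiv.ofSurjective sliceLI sliceLI_surjective).trans
    (Lp.fourierTransformₗᵢ ℝ (L2 Plane))

theorem fiberEquiv_apply (f : L2 Space) :
    fiberEquiv f = (𝓕 (sliceL2 f) : Lp (L2 Plane) 2 (volume : Measure ℝ)) := rfl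

theorem sliceL2_translation (R : ℝ) (f : L2 Space) :
    sliceL2 (translation R f) = shift R (sliceL2 f) := by
  refine Lp.ext ((sliceL2_ae_eq (Lp.coeFn_compMeasurePreserving f (measurePreserving_shift R))
    ?_).trans (coeFn_shift R _).symm)
  exact (measurePreserving_sub_right volume R).quasiMeasurePreserving.ae (ae_sliceL2_eq f)

theorem fiberEquiv_translation (R : ℝ) (f : L2 Space) :
    fiberEquiv (translation R f) = modulation R (fiberEquiv f) := by
  rw [fiberEquiv_apply, sliceL2_translation, Lp.fourier_shift, fiberEquiv_apply]

end Slices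

/-! ### Fibers of operators and plane waves. -/

section Fibers

theorem tensor_inner (u : L2 Plane) (v : L2 ℝ) (f : L2 Space) :
    ⟪tensor u v, f⟫ = ∫ t, starRingEnd ℂ (v t) * ⟪u, sliceL2 f t⟫ := by
  rw [← sliceLI.inner_map_map, L2.inner_def]
  refine integral_congr_ae ?_
  filter_upwards [sliceL2_tensor u v] with t ht
  change ⟪sliceL2 (tensor u v) t, sliceL2 f t⟫ = _
  rw [ht, inner_smul_left]

theorem enorm_tensor_sq (u : L2 Plane) (v : L2 ℝ) :
    ‖tensor u v‖ₑ ^ 2 = ‖u‖ₑ ^ 2 * ‖v‖ₑ ^ 2 := by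
  rw [← enorm_sliceL2, enorm_sq_eq_lintegral, enorm_sq_eq_lintegral v, ← lintegral_const_mul _
    ((Lp.stronglyMeasurable v).measurable.enorm.pow_const _)]
  refine lintegral_congr_ae ?_
  filter_upwards [sliceL2_tensor u v] with t ht
  rw [ht, enorm_smul, mul_pow, mul_comm]

theorem memLp_wave {I : Set ℝ} (hI : MeasurableSet I) (hI' : volume I ≠ ⊤) (ξ : ℝ) :
    MemLp (I.indicator fun t : ℝ => (Real.fourierChar (t * ξ) : ℂ)) 2 volume := by
  refine MemLp.mono (memLp_indicator_const 2 hI (1 : ℂ) (Or.inr hI')) ?_ ?_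
  · have : Continuous fun t : ℝ => (Real.fourierChar (t * ξ) : ℂ) := by
      have := Real.continuous_fourierChar
      fun_prop
    exact (this.stronglyMeasurable.indicator hI).aestronglyMeasurable
  · refine Filter.Eventually.of_forall fun t => ?_
    by_cases h : t ∈ I <;> simp [h, Circle.norm_coe]

/-- The plane wave `t ↦ e^{2πiξt}` restricted to `I`. -/
def wave {I : Set ℝ} (hI : MeasurableSet I) (hI' : volume I ≠ ⊤) (ξ : ℝ) : L2 ℝ :=
  (memLp_wave hI hI' ξ).toLp _

theorem coeFn_wave {I : Set ℝ} (hI : MeasurableSet I) (hI' : volume I ≠ ⊤) (ξ : ℝ) :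
    wave hI hI' ξ =ᵐ[volume] I.indicator fun t : ℝ => (Real.fourierChar (t * ξ) : ℂ) :=
  (memLp_wave hI hI' ξ).coeFn_toLp

theorem enorm_wave_sq {I : Set ℝ} (hI : MeasurableSet I) (hI' : volume I ≠ ⊤) (ξ : ℝ) :
    ‖wave hI hI' ξ‖ₑ ^ 2 = volume I := by
  rw [enorm_sq_eq_lintegral, ← lintegral_indicator_one hI]
  refine lintegral_congr_ae ?_
  filter_upwards [coeFn_wave hI hI' ξ] with t ht
  rw [ht]
  by_cases h : t ∈ I
  · simp [h, ← ofReal_norm, Circle.norm_coe]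
  · simp [h]

theorem conj_fourierChar (x : ℝ) :
    starRingEnd ℂ (Real.fourierChar x : ℂ) = (Real.fourierChar (-x) : ℂ) := by
  rw [AddChar.map_neg_eq_inv, Circle.coe_inv_eq_conj]

theorem integrable_of_support {H : Type} [NormedAddCommGroup H] {I : Set ℝ}
    (hI' : volume I ≠ ⊤) (F : Lp H 2 (volume : Measure ℝ)) (h : ∀ᵐ t : ℝ, t ∉ I → F t = 0) :
    Integrable F := by
  have : IsFiniteMeasure (volume.restrict I) := ⟨by simpa using hI'.lt_top⟩
  have h1 : IntegrableOn F I := ((Lp.memLp F).restrict I).integrable (by norm_num)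
  exact h1.integrable_of_ae_notMem_eq_zero h

/-- The fibers of a function supported in a slab of finite width are obtained by testing against
plane waves. -/
theorem inner_fiberEquiv {I : Set ℝ} (hI : MeasurableSet I) (hI' : volume I ≠ ⊤) {f : L2 Space}
    (hf : ∀ᵐ p : Space, p.2 ∉ I → f p = 0) (u : L2 Plane) :
    ∀ᵐ ξ : ℝ, ⟪u, fiberEquiv f ξ⟫ = ⟪tensor u (wave hI hI' ξ), f⟫ := by
  have h0 : ∀ᵐ t : ℝ, t ∉ I → sliceL2 f t = 0 := by
    filter_upwards [ae_sliceL2_eq f, ae_ae_swap hf] with t h1 h2 ht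
    refine Lp.ext ?_
    filter_upwards [h1, h2, Lp.coeFn_zero ℂ 2 (volume : Measure Plane)] with x h3 h4 h5
    rw [h3, h4 ht, h5, Pi.zero_apply]
  have hint := integrable_of_support hI' (sliceL2 f) h0
  filter_upwards [Lp.fourier_ae_eq_of_integrable _ hint] with ξ hξ
  rw [fiberEquiv_apply, hξ, tensor_inner, Real.fourier_real_eq, ← innerSL_apply_apply ℂ,
    ← ContinuousLinearMap.integral_comp_comm]
  · refine integral_congr_ae ?_
    filter_upwards [h0, coeFn_wave hI hI' ξ] with t h1 h2
    rw [h2]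
    by_cases ht : t ∈ I
    · rw [Set.indicator_of_mem ht, conj_fourierChar, Circle.smul_def, innerSL_apply_apply,
        inner_smul_right]
    · rw [h1 ht]
      simp
  · exact ((Real.fourierIntegral_convergent_iff ξ).2 hint).congr
      (Filter.Eventually.of_forall fun t => by simp [mul_comm])

theorem ae_comp_mul_left {p : ℝ → Prop} {a : ℝ} (ha : a ≠ 0) (h : ∀ᵐ k : ℝ, p k) :
    ∀ᵐ ξ : ℝ, p (a * ξ) := by
  refine Measure.QuasiMeasurePreserving.ae (f := fun ξ : ℝ => a * ξ) ⟨by fun_prop, ?_⟩ h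
  rw [Real.map_volume_mul_left ha]
  exact Measure.smul_absolutelyContinuous

/-- The substitution `k = 2πξ` preserves null sets, and the normalizing scalar cancels by linearity
of the fibers. -/
theorem isFiberFamily_iff {γ : L2 Space →L[ℂ] L2 Space} {γk : ℝ → L2 Plane →L[ℂ] L2 Plane} :
    IsFiberFamily γ γk ↔
      ∀ f : L2 Space, ∀ᵐ ξ : ℝ,
        fiberEquiv (γ f) ξ = γk (2 * Real.pi * ξ) (fiberEquiv f ξ) := by
  have hpi : 2 * Real.pi ≠ 0 := by positivity
  have hc : (((Real.sqrt (2 * Real.pi))⁻¹ : ℝ) : ℂ) ≠ 0 := by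
    rw [Complex.ofReal_ne_zero]
    positivity
  refine forall_congr' fun f => ⟨fun h => ?_, fun h => ?_⟩
  · filter_upwards [ae_comp_mul_left hpi h] with ξ hξ
    simp only [partialFourier, mul_div_cancel_left₀ _ hpi, map_smul] at hξ
    exact smul_right_injective _ hc hξ
  · filter_upwards [ae_comp_mul_left (inv_ne_zero hpi) h] with k hk
    have h1 : (2 * Real.pi)⁻¹ * k = k / (2 * Real.pi) := by rw [div_eq_inv_mul]
    rw [h1, mul_div_cancel₀ _ hpi] at hk
    simp only [partialFourier, map_smul]
    exact congrArg _ hk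

theorem inner_eq_integral_fibers {T : L2 Space →L[ℂ] L2 Space} {A : ℝ → L2 Plane →L[ℂ] L2 Plane}
    (h : ∀ f : L2 Space, ∀ᵐ ξ : ℝ, fiberEquiv (T f) ξ = A ξ (fiberEquiv f ξ)) (f : L2 Space) :
    ⟪f, T f⟫ = ∫ ξ, ⟪fiberEquiv f ξ, A ξ (fiberEquiv f ξ)⟫ := by
  rw [← fiberEquiv.inner_map_map, L2.inner_def]
  refine integral_congr_ae ?_
  filter_upwards [h f] with ξ hξ
  rw [hξ]

/-- The fibers of a positive operator are positive. -/
theorem ae_fibers_nonneg {T : L2 Space →L[ℂ] L2 Space} (hT : 0 ≤ T)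
    {A : ℝ → L2 Plane →L[ℂ] L2 Plane}
    (h : ∀ f : L2 Space, ∀ᵐ ξ : ℝ, fiberEquiv (T f) ξ = A ξ (fiberEquiv f ξ))
    (hint : ∀ (w : L2 Plane) (s : Set ℝ), MeasurableSet s → volume s < ⊤ →
      IntegrableOn (fun ξ => ⟪w, A ξ w⟫) s) :
    ∀ᵐ ξ, 0 ≤ A ξ := by
  have hset : ∀ (w : L2 Plane) (s : Set ℝ), MeasurableSet s → volume s < ⊤ →
      0 ≤ ∫ ξ in s, RCLike.re ⟪w, A ξ w⟫ ∧ ∫ ξ in s, RCLike.im ⟪w, A ξ w⟫ = 0 := by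
    intro w s hs hμs
    -- `f` has fibers `w` on `s` and `0` elsewhere, so the form of `T` at `f` is the integral of
    -- `⟨w, A ξ w⟩` over `s`.
    set f : L2 Space := fiberEquiv.symm (indicatorConstLp 2 hs hμs.ne w) with hf
    have h1 : ∫ ξ in s, ⟪w, A ξ w⟫ = ⟪f, T f⟫ := by
      rw [inner_eq_integral_fibers h, ← integral_indicator hs]
      refine integral_congr_ae ?_
      rw [hf, LinearIsometryEquiv.apply_symm_apply]
      filter_upwards [indicatorConstLp_coeFn (p := 2) (hs := hs) (hμs := hμs.ne) (c := w)]
        with ξ hξ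
      rw [hξ]
      by_cases hs' : ξ ∈ s <;> simp [hs']
    have hpos := (ContinuousLinearMap.nonneg_iff_isPositive _).1 hT
    have h2 := hpos.re_inner_nonneg_right f
    have h3 : RCLike.im ⟪f, T f⟫ = 0 := by
      have := ((ContinuousLinearMap.isPositive_iff_complex T).1 hpos f).1
      rw [hpos.inner_left_eq_inner_right] at this
      rw [← this]
      simp
    rw [← h1] at h2 h3
    refine ⟨?_, ?_⟩
    · rw [integral_re (hint w s hs hμs)]
      exact h2
    · rw [integral_im (hint w s hs hμs)]
      exact h3
  have hw : ∀ w : L2 Plane, ∀ᵐ ξ, 0 ≤ RCLike.re ⟪w, A ξ w⟫ ∧ RCLike.im ⟪w, A ξ w⟫ = 0 := by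
    intro w
    have h1 := ae_nonneg_of_forall_setIntegral_nonneg_of_sigmaFinite
      (f := fun ξ => RCLike.re ⟪w, A ξ w⟫) (μ := volume)
      (fun s hs hμs => (hint w s hs hμs).re) (fun s hs hμs => (hset w s hs hμs).1)
    have h2 := ae_eq_zero_of_forall_setIntegral_eq_of_sigmaFinite
      (f := fun ξ => RCLike.im ⟪w, A ξ w⟫) (μ := volume)
      (fun s hs hμs => (hint w s hs hμs).im) (fun s hs hμs => (hset w s hs hμs).2)
    filter_upwards [h1, h2] with ξ h3 h4
    exact ⟨h3, h4⟩
  have : Fact ((2 : ℝ≥0∞) ≠ ⊤) := ⟨by simp⟩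
  -- The exceptional null set depends on `w`; a countable dense set of `w` gives a common one, and
  -- the conditions are closed in `w`.
  obtain ⟨D, hDc, hD⟩ := TopologicalSpace.exists_countable_dense (L2 Plane)
  filter_upwards [(ae_ball_iff hDc).2 fun w (_ : w ∈ D) => hw w] with ξ hξ
  have hall : ∀ w : L2 Plane, 0 ≤ RCLike.re ⟪w, A ξ w⟫ ∧ RCLike.im ⟪w, A ξ w⟫ = 0 := by
    intro w
    refine hD.induction (P := fun w => 0 ≤ RCLike.re ⟪w, A ξ w⟫ ∧ RCLike.im ⟪w, A ξ w⟫ = 0)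
      (fun w hw => hξ w hw) ?_ w
    have hc : Continuous fun w => ⟪w, A ξ w⟫ := continuous_id.inner (A ξ).continuous
    exact (isClosed_le continuous_const (RCLike.continuous_re.comp hc)).inter
      (isClosed_eq (RCLike.continuous_im.comp hc) continuous_const)
  rw [ContinuousLinearMap.nonneg_iff_isPositive, ContinuousLinearMap.isPositive_iff_complex]
  intro w
  rw [← inner_conj_symm (A ξ w) w, RCLike.conj_re, RCLike.conj_eq_iff_im.2 (hall w).2]
  refine ⟨?_, (hall w).1⟩
  refine Complex.ext (by simp) ?_
  simpa using! (hall w).2.symm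

end Fibers

/-! ### Test functions as a dense subspace and as orthonormal families. -/

section TestFunctions

variable {X : Type} [NormedAddCommGroup X] [NormedSpace ℝ X]

theorem testFunction_differentiable {Ω : TopologicalSpace.Opens X} (φ : 𝓓(Ω, ℂ)) : Differentiable ℝ φ :=
  φ.contDiff.differentiable (by simp)

variable [MeasureSpace X]

section Linear

variable [OpensMeasurableSpace X] [IsFiniteMeasureOnCompacts (volume : Measure X)]
  {Ω : TopologicalSpace.Opens X}

theorem coeFn_testL2 (φ : 𝓓(Ω, ℂ)) : testL2 φ =ᵐ[volume] φ := (testFunction_memLp φ).coeFn_toLp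

theorem coeFn_testDerivL2 (φ : 𝓓(Ω, ℂ)) (v : X) :
    testDerivL2 φ v =ᵐ[volume] fun x => fderiv ℝ φ x v :=
  (testFunction_memLp_fderiv φ v).coeFn_toLp

variable (Ω) in
/-- The inclusion of test functions in `L²` as a linear map. -/
def testLinear : 𝓓(Ω, ℂ) →ₗ[ℂ] L2 X where
  toFun := testL2
  map_add' _ _ := rfl
  map_smul' _ _ := rfl

variable (Ω) in
/-- The partial derivative of test functions as a linear map to `L²`. -/
def testDerivLinear (v : X) : 𝓓(Ω, ℂ) →ₗ[ℂ] L2 X where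
  toFun φ := testDerivL2 φ v
  map_add' φ ψ := by
    rw [testDerivL2, testDerivL2, testDerivL2, ← MemLp.toLp_add]
    refine MemLp.toLp_congr _ _ (Filter.Eventually.of_forall fun x => ?_)
    have := fderiv_add (testFunction_differentiable φ x) (testFunction_differentiable ψ x)
    exact congrArg (fun L : X →L[ℝ] ℂ => L v) this
  map_smul' c φ := by
    rw [RingHom.id_apply, testDerivL2, testDerivL2, ← MemLp.toLp_const_smul]
    refine MemLp.toLp_congr _ _ (Filter.Eventually.of_forall fun x => ?_)
    have := fderiv_const_smul (testFunction_differentiable φ x) c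
    exact congrArg (fun L : X →L[ℝ] ℂ => L v) this

theorem tsum_le_kineticTrace {κ : Type} {d : ℕ} (v : Fin d → X) (A : L2 X →L[ℂ] L2 X)
    (u : κ → 𝓓(Ω, ℂ)) (hu : Orthonormal ℂ fun a => testL2 (u a)) :
    ∑' a, ∑ j, ENNReal.ofReal
      (RCLike.re ⟪testDerivL2 (u a) (v j), A (testDerivL2 (u a) (v j))⟫) ≤ kineticTrace v Ω A := by
  rw [ENNReal.tsum_eq_iSup_sum]
  refine iSup_le fun s => ?_
  refine le_trans (le_of_eq ?_) (le_iSup_of_le s.card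
    (le_iSup_of_le (fun i => u (s.equivFin.symm i)) (le_iSup_of_le
      (hu.comp _ (Subtype.val_injective.comp s.equivFin.symm.injective)) le_rfl)))
  rw [Equiv.sum_comp s.equivFin.symm (fun a : s => ∑ j, ENNReal.ofReal
      (RCLike.re ⟪testDerivL2 (u a) (v j), A (testDerivL2 (u a) (v j))⟫)),
    Finset.sum_coe_sort s (fun a => ∑ j, ENNReal.ofReal
      (RCLike.re ⟪testDerivL2 (u a) (v j), A (testDerivL2 (u a) (v j))⟫))]

theorem testL2_injective [(volume : Measure X).IsOpenPosMeasure] :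
    Function.Injective (testL2 : 𝓓(Ω, ℂ) → L2 X) := by
  intro φ ψ h
  have h1 : (φ : X → ℂ) =ᵐ[volume] ψ :=
    (coeFn_testL2 φ).symm.trans ((Lp.ext_iff.1 h).trans (coeFn_testL2 ψ))
  exact DFunLike.coe_injective ((φ.continuous.ae_eq_iff_eq _ ψ.continuous).1 h1)

end Linear

variable [BorelSpace X] [FiniteDimensional ℝ X] [IsLocallyFiniteMeasure (volume : Measure X)]
  {Ω : TopologicalSpace.Opens X}

/-- The residual `r` of the projection vanishes on `Ω` by the fundamental lemma of the calculus of
variations, while `f` vanishes outside. Hence `⟨r, f⟩ = 0`, which forces `r = 0`. -/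
theorem mem_closure_testFunctions (f : L2 X) (hf : ∀ᵐ x : X, x ∉ Ω → f x = 0) :
    f ∈ (LinearMap.range (testLinear Ω)).topologicalClosure := by
  set K := (LinearMap.range (testLinear Ω)).topologicalClosure with hK
  set r := f - K.starProjection f with hr
  have hrK : r ∈ Kᗮ := Submodule.sub_starProjection_mem_orthogonal f
  have hr0 : ∀ᵐ x : X, x ∈ (Ω : Set X) → r x = 0 := by
    refine Ω.isOpen.ae_eq_zero_of_integral_contDiff_smul_eq_zero
      (((Lp.memLp r).locallyIntegrable (by norm_num)).locallyIntegrableOn _) fun g hg hgc hgs => ?_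
    let φ : 𝓓(Ω, ℂ) := ⟨Complex.ofRealCLM ∘ g, by fun_prop, hgc.comp_left rfl,
      (tsupport_comp_subset (by simp) g).trans hgs⟩
    have h1 : ⟪testL2 φ, r⟫ = 0 :=
      (Submodule.mem_orthogonal _ _).1 hrK _ (Submodule.le_topologicalClosure _ ⟨φ, rfl⟩)
    rw [L2.inner_def] at h1
    rw [← h1]
    refine integral_congr_ae ?_
    filter_upwards [coeFn_testL2 φ] with x hx
    have h2 : φ x = (g x : ℂ) := rfl
    rw [hx, h2, RCLike.inner_apply, Complex.conj_ofReal, mul_comm, Complex.real_smul]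
  have h3 : ⟪r, r⟫ = 0 := by
    have h4 : ⟪r, K.starProjection f⟫ = 0 :=
      (Submodule.mem_orthogonal' _ _).1 hrK _ (K.starProjection_apply_mem f)
    have h5 : ⟪r, f⟫ = 0 := by
      rw [L2.inner_def]
      refine integral_eq_zero_of_ae ?_
      filter_upwards [hr0, hf] with x h6 h7
      by_cases hx : x ∈ Ω
      · simp [h6 hx]
      · simp [h7 hx]
    nth_rewrite 2 [hr]
    rw [inner_sub_right, h4, h5, sub_zero]
  rw [inner_self_eq_zero, hr, sub_eq_zero] at h3
  rw [h3]
  exact K.starProjection_apply_mem f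

/-- Orthogonalization stays in the linear span of test functions, so the completed family still
consists of test functions and is admissible in `kineticTrace`. -/
theorem exists_testBasis [(volume : Measure X).IsOpenPosMeasure] {n : ℕ} (φ : Fin n → 𝓓(Ω, ℂ))
    (hφ : Orthonormal ℂ fun i => testL2 (φ i)) :
    ∃ (κ : Type) (u : κ → 𝓓(Ω, ℂ)) (f : Fin n → κ), Orthonormal ℂ (fun a => testL2 (u a)) ∧
      Function.Injective f ∧ (∀ i, u (f i) = φ i) ∧
      ∀ x : L2 X, (∀ᵐ y : X, y ∉ Ω → x y = 0) →
        x ∈ (Submodule.span ℂ (Set.range fun a => testL2 (u a))).topologicalClosure := by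
  have : Fact ((2 : ℝ≥0∞) ≠ ⊤) := ⟨by simp⟩
  have : ProperSpace X := FiniteDimensional.proper_real X
  obtain ⟨κ, ε, f, hε, hεD, hf, hfe, hD⟩ := exists_orthonormal_extension
    (LinearMap.range (testLinear Ω)) hφ (fun i => ⟨φ i, rfl⟩)
  choose u hu using hεD
  have hu' : (fun a => testL2 (u a)) = ε := funext hu
  refine ⟨κ, u, f, hu' ▸ hε, hf, fun i => testL2_injective ?_, fun x hx => ?_⟩
  · exact (hu (f i)).trans (hfe i)
  · rw [hu']
    exact Submodule.topologicalClosure_minimal _ hD (Submodule.isClosed_topologicalClosure _)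
      (mem_closure_testFunctions x hx)

end TestFunctions

/-! ### Product test functions on the slab and their fibers. -/

section TensorTest

/-- The unit interval `(0, 1)`. -/
def openUnitInterval : TopologicalSpace.Opens ℝ := ⟨Set.Ioo 0 1, isOpen_Ioo⟩

/-- The test function `(x, t) ↦ u(x) v(t)` on the unit slab. -/
def tensorTest (u : 𝓓((⊤ : TopologicalSpace.Opens Plane), ℂ)) (v : 𝓓(openUnitInterval, ℂ)) :
    𝓓(unitSlab, ℂ) where
  toFun p := v p.2 * u p.1
  contDiff' := (v.contDiff.comp contDiff_snd).mul (u.contDiff.comp contDiff_fst)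
  hasCompactSupport' := by
    refine HasCompactSupport.intro (u.hasCompactSupport.isCompact.prod v.hasCompactSupport.isCompact)
      fun p hp => ?_
    rw [Set.mem_prod, not_and_or] at hp
    rcases hp with hp | hp
    · rw [image_eq_zero_of_notMem_tsupport hp, mul_zero]
    · rw [image_eq_zero_of_notMem_tsupport hp, zero_mul]
  tsupport_subset' := by
    have h : tsupport (fun p : Space => v p.2 * u p.1) ⊆ tsupport u ×ˢ tsupport v := by
      refine closure_minimal (fun p hp => ?_) ((isClosed_tsupport _).prod (isClosed_tsupport _))
      rw [Function.mem_support, mul_ne_zero_iff] at hp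
      exact ⟨subset_tsupport _ hp.2, subset_tsupport _ hp.1⟩
    exact fun p hp => ⟨trivial, v.tsupport_subset (h hp).2⟩

variable (u : 𝓓((⊤ : TopologicalSpace.Opens Plane), ℂ)) (v : 𝓓(openUnitInterval, ℂ))

theorem tensor_ae_eq {w : L2 Plane} {z : L2 ℝ} {f : Plane → ℂ} {g : ℝ → ℂ}
    (hf : w =ᵐ[volume] f) (hg : z =ᵐ[volume] g) :
    tensor w z =ᵐ[volume] fun p : Space => g p.2 * f p.1 := by
  refine (memLp_tensor w z).coeFn_toLp.trans ?_
  have h1 : ∀ᵐ p : Space, w p.1 = f p.1 := Measure.quasiMeasurePreserving_fst.ae hf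
  have h2 : ∀ᵐ p : Space, z p.2 = g p.2 := Measure.quasiMeasurePreserving_snd.ae hg
  filter_upwards [h1, h2] with p h3 h4
  rw [h3, h4]

theorem testL2_tensorTest : testL2 (tensorTest u v) = tensor (testL2 u) (testL2 v) :=
  Lp.ext ((coeFn_testL2 _).trans (tensor_ae_eq (coeFn_testL2 u) (coeFn_testL2 v)).symm)

theorem hasFDerivAt_tensorTest (p : Space) :
    HasFDerivAt (tensorTest u v) (v p.2 • (fderiv ℝ u p.1 ∘L ContinuousLinearMap.fst ℝ Plane ℝ) +
      u p.1 • (fderiv ℝ v p.2 ∘L ContinuousLinearMap.snd ℝ Plane ℝ)) p := by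
  have h1 : HasFDerivAt (fun p : Space => u p.1)
      (fderiv ℝ u p.1 ∘L ContinuousLinearMap.fst ℝ Plane ℝ) p :=
    (testFunction_differentiable u p.1).hasFDerivAt.comp p hasFDerivAt_fst
  have h2 : HasFDerivAt (fun p : Space => v p.2)
      (fderiv ℝ v p.2 ∘L ContinuousLinearMap.snd ℝ Plane ℝ) p :=
    (testFunction_differentiable v p.2).hasFDerivAt.comp p hasFDerivAt_snd
  exact h2.mul h1

theorem testDerivL2_tensorTest_fst (e : Plane) :
    testDerivL2 (tensorTest u v) (e, 0) = tensor (testDerivL2 u e) (testL2 v) := by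
  refine Lp.ext ((coeFn_testDerivL2 _ _).trans ?_)
  refine Filter.EventuallyEq.trans ?_
    (tensor_ae_eq (coeFn_testDerivL2 u e) (coeFn_testL2 v)).symm
  refine Filter.Eventually.of_forall fun p => ?_
  simp [(hasFDerivAt_tensorTest u v p).fderiv]

theorem testDerivL2_tensorTest_snd :
    testDerivL2 (tensorTest u v) (0, 1) = tensor (testL2 u) (testDerivL2 v 1) := by
  refine Lp.ext ((coeFn_testDerivL2 _ _).trans ?_)
  refine Filter.EventuallyEq.trans ?_
    (tensor_ae_eq (coeFn_testL2 u) (coeFn_testDerivL2 v 1)).symm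
  refine Filter.Eventually.of_forall fun p => ?_
  simp [(hasFDerivAt_tensorTest u v p).fderiv, mul_comm]

theorem inner_tensor_tensor (w w' : L2 Plane) (z z' : L2 ℝ) :
    ⟪tensor w z, tensor w' z'⟫ = ⟪w, w'⟫ * ⟪z, z'⟫ := by
  rw [tensor_inner, L2.inner_def z z', ← integral_const_mul]
  refine integral_congr_ae ?_
  filter_upwards [sliceL2_tensor w' z'] with t ht
  rw [ht, inner_smul_right, RCLike.inner_apply]
  ring

theorem orthonormal_tensor {ι κ : Type} {w : ι → L2 Plane} {z : κ → L2 ℝ} (hw : Orthonormal ℂ w)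
    (hz : Orthonormal ℂ z) : Orthonormal ℂ fun a : ι × κ => tensor (w a.1) (z a.2) := by
  classical
  rw [orthonormal_iff_ite] at *
  intro a b
  rw [inner_tensor_tensor, hw, hz]
  by_cases h1 : a.1 = b.1 <;> by_cases h2 : a.2 = b.2 <;> simp [h1, h2, Prod.ext_iff]

theorem testFunction_integrable (v : 𝓓(openUnitInterval, ℂ)) : Integrable v :=
  v.continuous.integrable_of_hasCompactSupport v.hasCompactSupport

theorem fiberEquiv_tensor (w : L2 Plane) {z : L2 ℝ} (hz : Integrable z) :
    fiberEquiv (tensor w z) =ᵐ[volume] fun ξ => 𝓕 (z : ℝ → ℂ) ξ • w := by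
  have h1 : Integrable (sliceL2 (tensor w z)) :=
    (hz.smul_const w).congr (sliceL2_tensor w z).symm
  filter_upwards [Lp.fourier_ae_eq_of_integrable _ h1] with ξ hξ
  rw [fiberEquiv_apply, hξ, Real.fourier_congr_ae (sliceL2_tensor w z), Real.fourier_real_eq,
    Real.fourier_real_eq, ← integral_smul_const]
  congr 1 with t
  rw [Circle.smul_def, Circle.smul_def, smul_assoc]

theorem fiberEquiv_tensor_testL2 (w : L2 Plane) :
    fiberEquiv (tensor w (testL2 v)) =ᵐ[volume] fun ξ => 𝓕 (v : ℝ → ℂ) ξ • w := by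
  filter_upwards [fiberEquiv_tensor w
    ((testFunction_integrable v).congr (coeFn_testL2 v).symm)] with ξ hξ
  rw [hξ, Real.fourier_congr_ae (coeFn_testL2 v)]

theorem fiberEquiv_tensor_testDerivL2 (w : L2 Plane) :
    fiberEquiv (tensor w (testDerivL2 v 1)) =ᵐ[volume]
      fun ξ => (2 * Real.pi * Complex.I * ξ * 𝓕 (v : ℝ → ℂ) ξ) • w := by
  have h1 : Integrable fun t => fderiv ℝ v t 1 :=
    ((v.contDiff.continuous_fderiv (by simp)).clm_apply
      continuous_const).integrable_of_hasCompactSupport (v.hasCompactSupport.fderiv_apply ℝ 1)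
  filter_upwards [fiberEquiv_tensor w (h1.congr (coeFn_testDerivL2 v 1).symm)] with ξ hξ
  have h2 := congrFun (Real.fourier_deriv (testFunction_integrable v)
    (testFunction_differentiable v) h1) ξ
  rw [hξ, Real.fourier_congr_ae (coeFn_testDerivL2 v 1)]
  congr 1

theorem volume_Ioo_ne_top : volume (Set.Ioo (0 : ℝ) 1) ≠ ⊤ := by simp

/-- `𝓕 v_b(ξ)` is the inner product of the cut-off plane wave with `v_b`; Parseval sums the squares
to the squared norm of that wave, the length of `(0,1)`. -/
theorem tsum_enorm_fourier_sq {κ : Type} {v : κ → 𝓓(openUnitInterval, ℂ)}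
    (hv : Orthonormal ℂ fun b => testL2 (v b))
    (hv' : ∀ x : L2 ℝ, (∀ᵐ y : ℝ, y ∉ openUnitInterval → x y = 0) →
        x ∈ (Submodule.span ℂ (Set.range fun b => testL2 (v b))).topologicalClosure) (ξ : ℝ) :
    ∑' b, ‖𝓕 (v b : ℝ → ℂ) ξ‖ₑ ^ 2 = 1 := by
  have h1 := hv.tsum_enorm_inner_sq (hv' (wave measurableSet_Ioo volume_Ioo_ne_top ξ) (by
    filter_upwards [coeFn_wave measurableSet_Ioo volume_Ioo_ne_top ξ] with t ht hn
    rw [ht]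
    exact Set.indicator_of_notMem hn _))
  rw [enorm_wave_sq] at h1
  refine Eq.trans ?_ (h1.trans (by simp))
  congr 1 with b
  congr 1
  rw [← inner_conj_symm, RCLike.enorm_conj, L2.inner_def, Real.fourier_real_eq]
  congr 1
  refine integral_congr_ae ?_
  filter_upwards [coeFn_testL2 (v b), coeFn_wave measurableSet_Ioo volume_Ioo_ne_top ξ]
    with t h2 h3
  rw [h2, h3, RCLike.inner_apply]
  by_cases ht : t ∈ Set.Ioo (0 : ℝ) 1
  · rw [Set.indicator_of_mem ht, conj_fourierChar, Circle.smul_def, smul_eq_mul, mul_comm]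
  · have : v b t = 0 := image_eq_zero_of_notMem_tsupport fun h => ht ((v b).tsupport_subset h)
    simp [this]

end TensorTest

/-! ### Lower bound for the kinetic trace in terms of the fibers. -/

section LowerBound

theorem lintegral_kinetic_ball {g : ℝ} (hg : 0 ≤ g) :
    ∫⁻ ξ in Set.Ioo (-(g / 2)) (g / 2), ENNReal.ofReal ((2 * Real.pi * ξ) ^ 2) =
      ENNReal.ofReal (Real.pi ^ 2 / 3) * ENNReal.ofReal (g ^ 3) := by
  have hint : IntegrableOn (fun ξ : ℝ => (2 * Real.pi * ξ) ^ 2) (Set.Ioo (-(g / 2)) (g / 2)) :=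
    (Continuous.integrableOn_Icc (by fun_prop)).mono_set Set.Ioo_subset_Icc_self
  rw [← ofReal_integral_eq_lintegral_ofReal hint (Filter.Eventually.of_forall fun _ => sq_nonneg _),
    ← integral_Ioc_eq_integral_Ioo, ← intervalIntegral.integral_of_le (by linarith),
    ← ENNReal.ofReal_mul (by positivity)]
  congr 1
  simp_rw [mul_pow]
  rw [intervalIntegral.integral_const_mul, integral_pow]
  push_cast
  ring

/-- The bathtub principle for the weight `(2πξ)²`. -/
theorem bathtub {q : ℝ → ℝ≥0∞} (hq : AEMeasurable q) (hq1 : ∀ᵐ ξ, q ξ ≤ 1) {g : ℝ} (hg : 0 ≤ g)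
    (hqg : ∫⁻ ξ, q ξ = ENNReal.ofReal g) :
    ENNReal.ofReal (Real.pi ^ 2 / 3) * ENNReal.ofReal (g ^ 3) ≤
      ∫⁻ ξ, ENNReal.ofReal ((2 * Real.pi * ξ) ^ 2) * q ξ := by
  set B := Set.Ioo (-(g / 2)) (g / 2) with hB
  set wt : ℝ → ℝ≥0∞ := fun ξ => ENNReal.ofReal ((2 * Real.pi * ξ) ^ 2) with hwt
  -- `r` is the value of the weight at the edge `|ξ| = g/2` of `B`.
  set r : ℝ≥0∞ := ENNReal.ofReal ((Real.pi * g) ^ 2) with hr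
  have hwtm : Measurable wt := by fun_prop
  have hvol : volume B = ENNReal.ofReal g := by
    rw [hB, Real.volume_Ioo]
    congr 1
    ring
  -- This is `(wt - r)(1_B - q) ≤ 0` without subtractions. After integration the terms in `r` cancel
  -- because `q` and `1_B` have the same integral.
  have hpt : ∀ᵐ ξ, B.indicator wt ξ + r * q ξ ≤ wt ξ * q ξ + B.indicator (fun _ => r) ξ := by
    filter_upwards [hq1] with ξ h1
    by_cases h : ξ ∈ B
    · rw [Set.indicator_of_mem h, Set.indicator_of_mem h]
      have h2 : wt ξ ≤ r := by
        refine ENNReal.ofReal_le_ofReal ?_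
        have h3 : |ξ| ≤ g / 2 := abs_le.2 ⟨h.1.le, h.2.le⟩
        rw [← sq_abs (2 * Real.pi * ξ), abs_mul, abs_of_pos (by positivity : 0 < 2 * Real.pi)]
        refine pow_le_pow_left₀ (by positivity) ?_ 2
        calc 2 * Real.pi * |ξ| ≤ 2 * Real.pi * (g / 2) := by gcongr
          _ = _ := by ring
      obtain ⟨d, hd⟩ := exists_add_of_le h2
      rw [hd, add_mul]
      calc wt ξ + (wt ξ * q ξ + d * q ξ) ≤ wt ξ + (wt ξ * q ξ + d * 1) := by gcongr
        _ = _ := by ring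
    · rw [Set.indicator_of_notMem h, Set.indicator_of_notMem h, zero_add, add_zero]
      gcongr
      refine ENNReal.ofReal_le_ofReal ?_
      have h3 : g / 2 ≤ |ξ| := by
        by_contra h4
        rw [not_le, abs_lt] at h4
        exact h h4
      rw [← sq_abs (2 * Real.pi * ξ), abs_mul, abs_of_pos (by positivity : 0 < 2 * Real.pi)]
      refine pow_le_pow_left₀ (by positivity) ?_ 2
      calc Real.pi * g = 2 * Real.pi * (g / 2) := by ring
        _ ≤ _ := by gcongr
  have h := lintegral_mono_ae hpt
  rw [lintegral_add_left (hwtm.indicator measurableSet_Ioo), lintegral_const_mul'' _ hq, hqg,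
    lintegral_add_right _ (measurable_const.indicator measurableSet_Ioo),
    lintegral_indicator measurableSet_Ioo, lintegral_indicator measurableSet_Ioo,
    setLIntegral_const, hvol, lintegral_kinetic_ball hg] at h
  exact (ENNReal.add_le_add_iff_right (ENNReal.mul_ne_top (by simp [hr]) (by simp))).1 h

variable {γ : L2 Space →L[ℂ] L2 Space} {A : ℝ → L2 Plane →L[ℂ] L2 Plane}

theorem ofReal_inner_eq_lintegral_fibers
    (h : ∀ f : L2 Space, ∀ᵐ ξ : ℝ, fiberEquiv (γ f) ξ = A ξ (fiberEquiv f ξ))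
    (hA : ∀ᵐ ξ, 0 ≤ A ξ) (f : L2 Space) :
    ENNReal.ofReal (RCLike.re ⟪f, γ f⟫) =
      ∫⁻ ξ, ENNReal.ofReal (RCLike.re ⟪fiberEquiv f ξ, A ξ (fiberEquiv f ξ)⟫) := by
  have hint : Integrable fun ξ => ⟪fiberEquiv f ξ, A ξ (fiberEquiv f ξ)⟫ := by
    refine (L2.integrable_inner (𝕜 := ℂ) (fiberEquiv f) (fiberEquiv (γ f))).congr ?_
    filter_upwards [h f] with ξ hξ
    rw [hξ]
  rw [inner_eq_integral_fibers h, ← integral_re hint, ofReal_integral_eq_lintegral_ofReal hint.re]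
  filter_upwards [hA] with ξ hξ
  exact ((ContinuousLinearMap.nonneg_iff_isPositive _).1 hξ).re_inner_nonneg_right _

theorem ofReal_inner_eq_lintegral_of_ae_eq_smul
    (h : ∀ f : L2 Space, ∀ᵐ ξ : ℝ, fiberEquiv (γ f) ξ = A ξ (fiberEquiv f ξ))
    (hA : ∀ᵐ ξ, 0 ≤ A ξ) {f : L2 Space} {c : ℝ → ℂ} {w : L2 Plane}
    (hf : fiberEquiv f =ᵐ[volume] fun ξ => c ξ • w) :
    ENNReal.ofReal (RCLike.re ⟪f, γ f⟫) =
      ∫⁻ ξ, ‖c ξ‖ₑ ^ 2 * ENNReal.ofReal (RCLike.re ⟪w, A ξ w⟫) := by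
  rw [ofReal_inner_eq_lintegral_fibers h hA]
  refine lintegral_congr_ae ?_
  filter_upwards [hf] with ξ hξ
  rw [hξ, map_smul, inner_smul_left, inner_smul_right, ← mul_assoc, RCLike.conj_mul,
    ← ofReal_norm_sq, ← ENNReal.ofReal_mul (by positivity)]
  congr 1
  rw [← RCLike.ofReal_pow, RCLike.re_ofReal_mul]

/-- On the products `u_a ⊗ v_b` the sum over `b` replaces `|𝓕 v_b|²` by 1, so the transverse terms
become the form of `G` on the derivatives of `u_a`, and the longitudinal one carries the weight
`(2πξ)²`. -/
theorem kineticTrace_ge_of_fibers {G : L2 Plane →L[ℂ] L2 Plane}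
    (h : ∀ f : L2 Space, ∀ᵐ ξ : ℝ, fiberEquiv (γ f) ξ = A ξ (fiberEquiv f ξ))
    (hA : ∀ᵐ ξ, 0 ≤ A ξ) (hA1 : ∀ᵐ ξ, A ξ ≤ 1)
    (hmeas : ∀ w, AEMeasurable fun ξ => ENNReal.ofReal (RCLike.re ⟪w, A ξ w⟫))
    (hG : ∀ w, ∫⁻ ξ, ENNReal.ofReal (RCLike.re ⟪w, A ξ w⟫) = ENNReal.ofReal (RCLike.re ⟪w, G w⟫))
    {ι : Type} {g : ι → ℝ} {φ : ι → L2 Plane} (hφ : Orthonormal ℂ φ) (hg : ∀ j, 0 ≤ g j)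
    (hd : IsDiagonal G g φ) :
    kineticTracePlane G + ∑' j, ENNReal.ofReal (Real.pi ^ 2 / 3) * ENNReal.ofReal (g j ^ 3) ≤
      kineticTrace spaceBasis unitSlab γ := by
  set q : L2 Plane → ℝ → ℝ≥0∞ := fun w ξ => ENNReal.ofReal (RCLike.re ⟪w, A ξ w⟫) with hq
  set C := ∑' j, ENNReal.ofReal (Real.pi ^ 2 / 3) * ENNReal.ofReal (g j ^ 3) with hC
  have : Fact ((2 : ℝ≥0∞) ≠ ⊤) := ⟨by simp⟩
  -- Both terms must come from one test family, so `C` is added to each finite sum before the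
  -- supremum is taken. The empty family yields `C` alone, which settles infinite `C`; otherwise `C`
  -- may be subtracted.
  suffices hfam : ∀ (n : ℕ) (ψ : Fin n → 𝓓((⊤ : TopologicalSpace.Opens Plane), ℂ)),
      Orthonormal ℂ (fun i => testL2 (ψ i)) →
      (∑ i, ∑ j : Fin 2, ENNReal.ofReal (RCLike.re
        ⟪testDerivL2 (ψ i) (EuclideanSpace.single j 1),
          G (testDerivL2 (ψ i) (EuclideanSpace.single j 1))⟫)) + C ≤
        kineticTrace spaceBasis unitSlab γ by
    have hCle : C ≤ kineticTrace spaceBasis unitSlab γ := by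
      have := hfam 0 (fun i => i.elim0) (by
        rw [orthonormal_iff_ite]
        exact fun i => i.elim0)
      simpa using this
    by_cases hCtop : C = ⊤
    · rw [hCtop, top_le_iff] at hCle
      rw [hCle]
      exact le_top
    · have h1 : kineticTracePlane G ≤ kineticTrace spaceBasis unitSlab γ - C :=
        iSup_le fun n => iSup_le fun ψ => iSup_le fun hψ =>
          ENNReal.le_sub_of_add_le_right hCtop (hfam n ψ hψ)
      calc _ ≤ kineticTrace spaceBasis unitSlab γ - C + C := by gcongr
        _ = _ := tsub_add_cancel_of_le hCle
  intro n ψ hψ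
  obtain ⟨κ, u, f, hu, hf, hfu, hucomp⟩ := exists_testBasis ψ hψ
  obtain ⟨κ', v, -, hv, -, -, hvcomp⟩ := exists_testBasis (Ω := openUnitInterval) (n := 0)
    (fun i => i.elim0) (by rw [orthonormal_iff_ite]; exact fun i => i.elim0)
  have hκ : Countable κ := hu.countable
  have hκ' : Countable κ' := hv.countable
  have hι : Countable ι := hφ.countable
  have hutop : (Submodule.span ℂ (Set.range fun a => testL2 (u a))).topologicalClosure = ⊤ :=
    Submodule.eq_top_iff'.2 fun x => hucomp x (Filter.Eventually.of_forall fun y hy =>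
      absurd trivial hy)
  have hFm : ∀ b, Measurable fun ξ => ‖𝓕 (v b : ℝ → ℂ) ξ‖ₑ ^ 2 := fun b =>
    (continuous_fourier_of_integrable (testFunction_integrable (v b))).measurable.enorm.pow_const _
  have hsum : ∀ w : L2 Plane, ∑' b, ∫⁻ ξ, ‖𝓕 (v b : ℝ → ℂ) ξ‖ₑ ^ 2 * q w ξ = ∫⁻ ξ, q w ξ := by
    intro w
    rw [← lintegral_tsum (f := fun b ξ => ‖𝓕 (v b : ℝ → ℂ) ξ‖ₑ ^ 2 * q w ξ)
      fun b => (hFm b).aemeasurable.mul (hmeas w)]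
    simp_rw [ENNReal.tsum_mul_right, tsum_enorm_fourier_sq hv hvcomp, one_mul]
  have hsum' : ∀ w : L2 Plane,
      ∑' b, ∫⁻ ξ, ‖2 * Real.pi * Complex.I * ξ * 𝓕 (v b : ℝ → ℂ) ξ‖ₑ ^ 2 * q w ξ =
        ∫⁻ ξ, ENNReal.ofReal ((2 * Real.pi * ξ) ^ 2) * q w ξ := by
    intro w
    have h1 : ∀ b ξ, ‖2 * Real.pi * Complex.I * ξ * 𝓕 (v b : ℝ → ℂ) ξ‖ₑ ^ 2 =
        ENNReal.ofReal ((2 * Real.pi * ξ) ^ 2) * ‖𝓕 (v b : ℝ → ℂ) ξ‖ₑ ^ 2 := by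
      intro b ξ
      rw [enorm_mul, mul_pow, ← ofReal_norm_sq]
      congr 2
      rw [norm_mul, norm_mul, norm_mul, Complex.norm_I, Complex.norm_real, Complex.norm_real,
        Complex.norm_ofNat, mul_one, ← sq_abs (2 * Real.pi * ξ), abs_mul, abs_mul, abs_two]
      rfl
    simp_rw [h1]
    have hwm : Measurable fun ξ : ℝ => ENNReal.ofReal ((2 * Real.pi * ξ) ^ 2) := by fun_prop
    rw [← lintegral_tsum (f := fun b ξ => ENNReal.ofReal ((2 * Real.pi * ξ) ^ 2) *
      ‖𝓕 (v b : ℝ → ℂ) ξ‖ₑ ^ 2 * q w ξ) fun b => (hwm.mul (hFm b)).aemeasurable.mul (hmeas w)]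
    simp_rw [ENNReal.tsum_mul_right, ENNReal.tsum_mul_left, tsum_enorm_fourier_sq hv hvcomp,
      mul_one]
  have hfamily := tsum_le_kineticTrace spaceBasis γ
    (fun a : κ × κ' => tensorTest (u a.1) (v a.2)) (by
      simp_rw [testL2_tensorTest]
      exact orthonormal_tensor (w := fun a => testL2 (u a)) (z := fun b => testL2 (v b)) hu hv)
  refine le_trans ?_ hfamily
  have hterm : ∀ a : κ × κ', ∑ j, ENNReal.ofReal (RCLike.re
      ⟪testDerivL2 (tensorTest (u a.1) (v a.2)) (spaceBasis j),
        γ (testDerivL2 (tensorTest (u a.1) (v a.2)) (spaceBasis j))⟫) =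
      (∫⁻ ξ, ‖𝓕 (v a.2 : ℝ → ℂ) ξ‖ₑ ^ 2 *
          q (testDerivL2 (u a.1) (EuclideanSpace.single 0 1)) ξ) +
        (∫⁻ ξ, ‖𝓕 (v a.2 : ℝ → ℂ) ξ‖ₑ ^ 2 *
          q (testDerivL2 (u a.1) (EuclideanSpace.single 1 1)) ξ) +
        ∫⁻ ξ, ‖2 * Real.pi * Complex.I * ξ * 𝓕 (v a.2 : ℝ → ℂ) ξ‖ₑ ^ 2 *
          q (testL2 (u a.1)) ξ := by
    intro a
    rw [Fin.sum_univ_three]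
    have e0 : spaceBasis 0 = (EuclideanSpace.single 0 1, 0) := rfl
    have e1 : spaceBasis 1 = (EuclideanSpace.single 1 1, 0) := rfl
    have e2 : spaceBasis 2 = (0, 1) := rfl
    rw [e0, e1, e2, testDerivL2_tensorTest_fst, testDerivL2_tensorTest_fst,
      testDerivL2_tensorTest_snd,
      ofReal_inner_eq_lintegral_of_ae_eq_smul h hA (fiberEquiv_tensor_testL2 (v a.2) _),
      ofReal_inner_eq_lintegral_of_ae_eq_smul h hA (fiberEquiv_tensor_testL2 (v a.2) _),
      ofReal_inner_eq_lintegral_of_ae_eq_smul h hA (fiberEquiv_tensor_testDerivL2 (v a.2) _)]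
  simp_rw [hterm]
  rw [ENNReal.tsum_prod']
  simp_rw [ENNReal.tsum_add, hsum, hsum']
  refine add_le_add ?_ ?_
  · simp_rw [hq, hG]
    rw [← ENNReal.tsum_add, ← tsum_fintype (L := .unconditional _)]
    refine le_trans (ENNReal.tsum_le_tsum fun i => ?_) (ENNReal.tsum_comp_le_tsum_of_injective hf _)
    rw [Fin.sum_univ_two, hfu]
  · have hwm : Measurable fun ξ : ℝ => ENNReal.ofReal ((2 * Real.pi * ξ) ^ 2) := by fun_prop
    rw [← lintegral_tsum (f := fun a ξ => ENNReal.ofReal ((2 * Real.pi * ξ) ^ 2) *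
      q (testL2 (u a)) ξ) fun a => hwm.aemeasurable.mul (hmeas _)]
    -- The bathtub bound needs the diagonal elements along `φ`, whereas the test family is `u`; at
    -- fixed `ξ` the passage from `φ` to the complete family `u` only increases the trace of `A ξ`.
    calc C ≤ ∑' j, ∫⁻ ξ, ENNReal.ofReal ((2 * Real.pi * ξ) ^ 2) * q (φ j) ξ := by
          refine ENNReal.tsum_le_tsum fun j => bathtub (hmeas _) ?_ (hg j) ?_
          · filter_upwards [hA1] with ξ hξ
            have h1 := ((ContinuousLinearMap.le_def _ _).1 hξ).re_inner_nonneg_right (φ j)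
            rw [sub_apply, inner_sub_right, one_apply_eq_self, inner_self_eq_norm_sq_to_K, hφ.1,
              map_sub] at h1
            rw [ENNReal.ofReal_le_one]
            simpa using h1
          · rw [hG, hd.apply_self hφ, inner_smul_right, inner_self_eq_norm_sq_to_K, hφ.1]
            simp
      _ = ∫⁻ ξ, ∑' j, ENNReal.ofReal ((2 * Real.pi * ξ) ^ 2) * q (φ j) ξ := by
          rw [← lintegral_tsum (f := fun j ξ => ENNReal.ofReal ((2 * Real.pi * ξ) ^ 2) *
            q (φ j) ξ) fun a => hwm.aemeasurable.mul (hmeas _)]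
      _ ≤ _ := by
          refine lintegral_mono_ae ?_
          filter_upwards [hA] with ξ hξ
          rw [ENNReal.tsum_mul_left, ENNReal.tsum_mul_left]
          gcongr
          exact tsum_inner_le_of_complete hξ hu hutop hφ

end LowerBound

/-! ### Lower bound for the energy of an admissible state. -/

section EnergyLowerBound

theorem ofReal_pi_sq_div_six :
    ENNReal.ofReal (Real.pi ^ 2 / 6) = 1 / 2 * ENNReal.ofReal (Real.pi ^ 2 / 3) := by
  have : (1 / 2 : ℝ≥0∞) = ENNReal.ofReal (1 / 2) := by
    rw [ENNReal.ofReal_div_of_pos (by norm_num)]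
    simp
  rw [this, ← ENNReal.ofReal_mul (by norm_num)]
  congr 1
  ring

theorem kineticEnergy_ge {γ : L2 Space →L[ℂ] L2 Space} {G : L2 Plane →L[ℂ] L2 Plane}
    (hγ : γ ∈ states) (hΛ : HasReducedState γ G) {ι : Type} {g : ι → ℝ} {φ : ι → L2 Plane}
    (hφ : Orthonormal ℂ φ) (hg : ∀ j, 0 ≤ g j) (hd : IsDiagonal G g φ) :
    (1 / 2) * kineticTracePlane G + ENNReal.ofReal (Real.pi ^ 2 / 6) * posTrace (G ^ 3) ≤
      kineticEnergy γ := by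
  obtain ⟨-, hγ0, hγ1, -⟩ := hγ
  obtain ⟨γk, hfib, hred⟩ := hΛ
  have hpi : 2 * Real.pi ≠ 0 := by positivity
  rw [isFiberFamily_iff] at hfib
  have hint : ∀ w, Integrable fun ξ => ⟪w, γk (2 * Real.pi * ξ) w⟫ := fun w =>
    (hred w w).1.comp_mul_left' hpi
  have hA : ∀ᵐ ξ, 0 ≤ γk (2 * Real.pi * ξ) :=
    ae_fibers_nonneg hγ0 hfib fun w s _ _ => (hint w).integrableOn
  -- The upper bound on the fibers is positivity of the fibers of `1 - γ`. Set integrability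
  -- suffices there, since the constant `1` is not integrable on the line.
  have hA1 : ∀ᵐ ξ, 0 ≤ 1 - γk (2 * Real.pi * ξ) := by
    refine ae_fibers_nonneg (T := 1 - γ) (sub_nonneg.2 hγ1) (fun f => ?_) fun w s hs hμs => ?_
    · have h1 : fiberEquiv ((1 - γ) f) = fiberEquiv f - fiberEquiv (γ f) := by
        rw [sub_apply, map_sub, one_apply_eq_self]
      rw [h1]
      filter_upwards [hfib f, Lp.coeFn_sub (fiberEquiv f) (fiberEquiv (γ f))] with ξ h2 h3
      rw [h3, Pi.sub_apply, h2, sub_apply, one_apply_eq_self]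
    · simp_rw [sub_apply, inner_sub_right]
      exact (integrableOn_const hμs.ne).sub (hint w).integrableOn
  have h := kineticTrace_ge_of_fibers (A := fun ξ => γk (2 * Real.pi * ξ)) hfib hA
    (by filter_upwards [hA1] with ξ hξ using sub_nonneg.1 hξ)
    (fun w => (hint w).re.aestronglyMeasurable.aemeasurable.ennreal_ofReal)
    (fun w => by
      rw [← ofReal_integral_eq_lintegral_ofReal (hint w).re, integral_re (hint w), (hred w w).2,
        Measure.integral_comp_mul_left (fun k => ⟪w, γk k w⟫)]
      · rw [abs_of_pos (by positivity), one_div]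
        congr 1
      · filter_upwards [hA] with ξ hξ
        exact ((ContinuousLinearMap.nonneg_iff_isPositive _).1 hξ).re_inner_nonneg_right _)
    hφ hg hd
  rw [ENNReal.tsum_mul_left, ← (hd.pow_three hφ).posTrace_eq (fun j => pow_nonneg (hg j) 3) hφ] at h
  rw [kineticEnergy, ofReal_pi_sq_div_six, mul_assoc, ← mul_add]
  gcongr

end EnergyLowerBound

/-! ### The optimal state and its admissibility. -/

section OptimalState

variable {ι : Type} {φ : ι → L2 Plane}

/-- The orthogonal projection onto the closed span of the `φ j` with `j ∈ s`. -/
def spanProj (φ : ι → L2 Plane) (s : Set ι) : L2 Plane →L[ℂ] L2 Plane :=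
  (Submodule.span ℂ (Set.range fun j : s => φ j)).topologicalClosure.starProjection

theorem spanProj_isDiagonal (hφ : Orthonormal ℂ φ) (s : Set ι) :
    IsDiagonal (spanProj φ s) (fun j => s.indicator 1 j) φ := by
  intro u
  have h := (hφ.comp (fun j : s => (j : ι)) Subtype.val_injective).hasSum_starProjection u
  have h1 := (hasSum_subtype_iff_indicator (f := fun j => ⟪φ j, u⟫ • φ j)).1 h
  refine h1.congr_fun fun j => ?_
  by_cases hj : j ∈ s <;> simp [hj]

theorem norm_spanProj_le (s : Set ι) (u : L2 Plane) : ‖spanProj φ s u‖ ≤ ‖u‖ :=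
  Submodule.norm_starProjection_apply_le _ _

/-- The fibers of the optimal state. -/
def optimalFiber (g : ι → ℝ) (φ : ι → L2 Plane) (k : ℝ) : L2 Plane →L[ℂ] L2 Plane :=
  spanProj φ {j | |k| < Real.pi * g j}

variable {g : ι → ℝ}

theorem optimalFiber_isDiagonal (hφ : Orthonormal ℂ φ) (k : ℝ) :
    IsDiagonal (optimalFiber g φ k)
      (fun j => Set.indicator {κ : ℝ | |κ| < Real.pi * g j} 1 k) φ :=
  spanProj_isDiagonal hφ _

theorem stronglyMeasurable_optimalFiber (hφ : Orthonormal ℂ φ) (u : L2 Plane) :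
    StronglyMeasurable fun k => optimalFiber g φ k u := by
  have : Fact ((2 : ℝ≥0∞) ≠ ⊤) := ⟨by simp⟩
  have : Countable ι := hφ.countable
  refine stronglyMeasurable_of_tendsto (Filter.atTop : Filter (Finset ι))
    (f := fun s k => ∑ j ∈ s, ((Set.indicator {κ : ℝ | |κ| < Real.pi * g j} 1 k : ℝ) : ℂ) •
      ⟪φ j, u⟫ • φ j) (fun s => ?_) ?_
  · refine Finset.stronglyMeasurable_fun_sum s fun j _ => ?_
    refine StronglyMeasurable.smul_const ?_ _
    refine (Complex.measurable_ofReal.comp ?_).stronglyMeasurable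
    exact measurable_one.indicator (measurableSet_lt (by fun_prop) measurable_const)
  · rw [tendsto_pi_nhds]
    exact fun k => optimalFiber_isDiagonal hφ k u

/-- The optimal state, in the Fourier representation. -/
def optimalMul (g : ι → ℝ) (hφ : Orthonormal ℂ φ) :
    Lp (L2 Plane) 2 (volume : Measure ℝ) →L[ℂ] Lp (L2 Plane) 2 (volume : Measure ℝ) :=
  fiberMul (fun ξ => optimalFiber g φ (2 * Real.pi * ξ))
    (fun u => (stronglyMeasurable_optimalFiber hφ u).comp_measurable (by fun_prop))
    (fun _ u => norm_spanProj_le _ u)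

theorem coeFn_optimalMul (g : ι → ℝ) (hφ : Orthonormal ℂ φ)
    (F : Lp (L2 Plane) 2 (volume : Measure ℝ)) :
    optimalMul g hφ F =ᵐ[volume] fun ξ => optimalFiber g φ (2 * Real.pi * ξ) (F ξ) :=
  coeFn_fiberMul _ _ _ F

/-- The optimal state. -/
def optimalState (g : ι → ℝ) (hφ : Orthonormal ℂ φ) : L2 Space →L[ℂ] L2 Space :=
  (fiberEquiv.symm.toContinuousLinearEquiv : _ →L[ℂ] L2 Space) ∘L optimalMul g hφ ∘L
    (fiberEquiv.toContinuousLinearEquiv : L2 Space →L[ℂ] _)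

theorem fiberEquiv_optimalState (g : ι → ℝ) (hφ : Orthonormal ℂ φ) (f : L2 Space) :
    fiberEquiv (optimalState g hφ f) = optimalMul g hφ (fiberEquiv f) :=
  fiberEquiv.apply_symm_apply _

theorem fiberEquiv_optimalState_ae (g : ι → ℝ) (hφ : Orthonormal ℂ φ) (f : L2 Space) :
    ∀ᵐ ξ : ℝ, fiberEquiv (optimalState g hφ f) ξ =
      optimalFiber g φ (2 * Real.pi * ξ) (fiberEquiv f ξ) := by
  rw [fiberEquiv_optimalState]
  exact coeFn_optimalMul g hφ _

theorem optimalState_isFiberFamily (g : ι → ℝ) (hφ : Orthonormal ℂ φ) :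
    IsFiberFamily (optimalState g hφ) (optimalFiber g φ) :=
  isFiberFamily_iff.2 fun f => fiberEquiv_optimalState_ae g hφ f

/-- Every fiber is an orthogonal projection, and idempotence and symmetry pass through the unitary
`fiberEquiv`. The bounds `0 ≤ γ ≤ 1` follow. -/
theorem optimalState_isStarProjection (g : ι → ℝ) (hφ : Orthonormal ℂ φ) :
    IsStarProjection (optimalState g hφ) := by
  refine ⟨?_, ?_⟩
  · ext1 f
    refine fiberEquiv.injective ?_
    rw [mul_apply_eq_comp, fiberEquiv_optimalState]
    refine Lp.ext ?_
    filter_upwards [coeFn_optimalMul g hφ (fiberEquiv (optimalState g hφ f)),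
      fiberEquiv_optimalState_ae g hφ f] with ξ h1 h2
    rw [h1, h2]
    exact congrArg (fun T : L2 Plane →L[ℂ] L2 Plane => T (fiberEquiv f ξ))
      (Submodule.isIdempotentElem_starProjection _)
  · rw [ContinuousLinearMap.isSelfAdjoint_iff_isSymmetric]
    intro f h
    change ⟪optimalState g hφ f, h⟫ = ⟪f, optimalState g hφ h⟫
    rw [← fiberEquiv.inner_map_map, ← fiberEquiv.inner_map_map f, L2.inner_def, L2.inner_def]
    refine integral_congr_ae ?_
    filter_upwards [fiberEquiv_optimalState_ae g hφ f, fiberEquiv_optimalState_ae g hφ h]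
      with ξ h1 h2
    rw [h1, h2]
    exact Submodule.inner_starProjection_left_eq_right _ _ _

theorem optimalState_comm_translation (g : ι → ℝ) (hφ : Orthonormal ℂ φ) (R : ℝ) :
    translation R ∘L optimalState g hφ = optimalState g hφ ∘L translation R := by
  ext1 f
  refine fiberEquiv.injective ?_
  rw [ContinuousLinearMap.comp_apply, ContinuousLinearMap.comp_apply, fiberEquiv_translation,
    fiberEquiv_optimalState, fiberEquiv_optimalState, fiberEquiv_translation]
  refine Lp.ext ?_
  filter_upwards [coeFn_modulation R (optimalMul g hφ (fiberEquiv f)),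
    coeFn_optimalMul g hφ (fiberEquiv f), coeFn_optimalMul g hφ (modulation R (fiberEquiv f)),
    coeFn_modulation R (fiberEquiv f)] with ξ h1 h2 h3 h4
  rw [h1, h2, h3, h4, map_smul]

/-- The frequencies occupied by the `j`-th transverse mode. -/
def occupied (g : ι → ℝ) (j : ι) : Set ℝ := Set.Ioo (-(g j / 2)) (g j / 2)

theorem mem_occupied_iff {j : ι} {ξ : ℝ} :
    ξ ∈ occupied g j ↔ |2 * Real.pi * ξ| < Real.pi * g j := by
  have hpi := Real.pi_pos
  rw [occupied, Set.mem_Ioo, ← abs_lt, abs_mul, abs_of_pos (by positivity : 0 < 2 * Real.pi),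
    mul_comm 2, mul_assoc, mul_lt_mul_iff_right₀ hpi]
  constructor <;> intro h <;> linarith

theorem volume_occupied (j : ι) : volume (occupied g j) = ENNReal.ofReal (g j) := by
  rw [occupied, Real.volume_Ioo]
  congr 1
  ring

theorem measurableSet_occupied (j : ι) : MeasurableSet (occupied g j) := measurableSet_Ioo

theorem ofReal_inner_optimalState (g : ι → ℝ) (hφ : Orthonormal ℂ φ) (f : L2 Space) :
    ENNReal.ofReal (RCLike.re ⟪f, optimalState g hφ f⟫) =
      ∑' j, ∫⁻ ξ in occupied g j, ‖⟪φ j, fiberEquiv f ξ⟫‖ₑ ^ 2 := by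
  have : Fact ((2 : ℝ≥0∞) ≠ ⊤) := ⟨by simp⟩
  have : Countable ι := hφ.countable
  rw [ofReal_inner_eq_lintegral_fibers (fiberEquiv_optimalState_ae g hφ)]
  · simp_rw [← lintegral_indicator (measurableSet_occupied _)]
    rw [← lintegral_tsum]
    · refine lintegral_congr fun ξ => ?_
      rw [(optimalFiber_isDiagonal hφ _).ofReal_inner fun j =>
        Set.indicator_nonneg (fun _ _ => zero_le_one) _]
      congr 1 with j
      by_cases h : ξ ∈ occupied g j
      · have h' : 2 * Real.pi * ξ ∈ {κ : ℝ | |κ| < Real.pi * g j} := mem_occupied_iff.1 h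
        rw [Set.indicator_of_mem h, Set.indicator_of_mem h']
        simp
      · have h' : 2 * Real.pi * ξ ∉ {κ : ℝ | |κ| < Real.pi * g j} := fun h' =>
          h (mem_occupied_iff.2 h')
        rw [Set.indicator_of_notMem h, Set.indicator_of_notMem h']
        simp
    · intro j
      have h1 : AEStronglyMeasurable (fun ξ => ⟪φ j, fiberEquiv f ξ⟫) volume :=
        aestronglyMeasurable_const.inner (Lp.aestronglyMeasurable _)
      exact (h1.enorm.pow_const _).indicator (measurableSet_occupied j)
  · exact Filter.Eventually.of_forall fun ξ => (ContinuousLinearMap.nonneg_iff_isPositive _).2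
      (ContinuousLinearMap.IsPositive.of_isStarProjection isStarProjection_starProjection)

/-- This reduces each upper bound on a trace to a Bessel bound at fixed mode and frequency. Modes
with `g j ≤ 0` occupy a null set of frequencies, so nothing is asked of them. -/
theorem sum_inner_optimalState_le (g : ι → ℝ) (hφ : Orthonormal ℂ φ) {n : ℕ}
    (f : Fin n → L2 Space) (c : ι → ℝ → ℝ≥0∞)
    (hc : ∀ j, 0 < g j → ∀ᵐ ξ, ∑ i, ‖⟪φ j, fiberEquiv (f i) ξ⟫‖ₑ ^ 2 ≤ c j ξ) :
    ∑ i, ENNReal.ofReal (RCLike.re ⟪f i, optimalState g hφ (f i)⟫) ≤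
      ∑' j, ∫⁻ ξ in occupied g j, c j ξ := by
  simp_rw [ofReal_inner_optimalState]
  rw [← tsum_fintype (L := .unconditional _), ENNReal.tsum_comm]
  refine ENNReal.tsum_le_tsum fun j => ?_
  by_cases hj : 0 < g j
  · rw [tsum_fintype, ← lintegral_finsetSum' _ fun i _ => ?_]
    · exact lintegral_mono_ae (ae_restrict_of_ae (hc j hj))
    · have h1 : AEStronglyMeasurable (fun ξ => ⟪φ j, fiberEquiv (f i) ξ⟫) volume :=
        aestronglyMeasurable_const.inner (Lp.aestronglyMeasurable _)
      exact (h1.enorm.pow_const _).restrict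
  · have : volume (occupied g j) = 0 := by
      rw [volume_occupied, ENNReal.ofReal_eq_zero]
      exact not_lt.1 hj
    simp [Measure.restrict_eq_zero.2 this]

/-- Bessel's inequality for the single vector `w ⊗ wave`, whose squared norm is `‖w‖² |I|`. -/
theorem sum_inner_le_of_support {I : Set ℝ} (hI : MeasurableSet I) (hI' : volume I ≠ ⊤) {n : ℕ}
    {e : Fin n → L2 Space} (he : Orthonormal ℂ e) (w : L2 Plane) (ξ : ℝ) :
    ∑ i, ‖⟪tensor w (wave hI hI' ξ), e i⟫‖ₑ ^ 2 ≤ ‖w‖ₑ ^ 2 * volume I := by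
  rw [← enorm_wave_sq hI hI' ξ, ← enorm_tensor_sq, ← tsum_fintype (L := .unconditional _)]
  refine le_trans (le_of_eq ?_) (he.tsum_enorm_inner_sq_le _)
  congr 1 with i
  rw [← inner_conj_symm, RCLike.enorm_conj]

/-- Only the projection `I` of `K` to the `x₃` axis matters: each mode contributes at most `|I| g
j`, so the local trace is at most `|I| Tr G`. -/
theorem optimalState_isLocallyTraceClass (hφ : Orthonormal ℂ φ)
    (hsum : ∑' j, ENNReal.ofReal (g j) ≠ ⊤) : IsLocallyTraceClass (optimalState g hφ) := by
  intro K hK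
  set I : Set ℝ := Prod.snd '' K with hIdef
  have hIc : IsCompact I := hK.image continuous_snd
  have hI : MeasurableSet I := hIc.measurableSet
  have hI' : volume I ≠ ⊤ := hIc.measure_lt_top.ne
  have hle : traceOn {f : L2 Space | ∀ᵐ x ∂(volume : Measure Space), x ∉ K → f x = 0}
      (optimalState g hφ) ≤ volume I * ∑' j, ENNReal.ofReal (g j) := by
    refine iSup_le fun n => iSup_le fun e => iSup_le fun he => iSup_le fun heK => ?_
    refine (sum_inner_optimalState_le g hφ e (fun _ _ => volume I) fun j _ => ?_).trans ?_
    · have h1 : ∀ i, ∀ᵐ ξ : ℝ, ⟪φ j, fiberEquiv (e i) ξ⟫ =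
          ⟪tensor (φ j) (wave hI hI' ξ), e i⟫ := by
        intro i
        refine inner_fiberEquiv hI hI' ?_ _
        filter_upwards [heK i] with p hp hn
        exact hp fun h => hn ⟨p, h, rfl⟩
      filter_upwards [ae_all_iff.2 h1] with ξ hξ
      simp_rw [hξ]
      refine (sum_inner_le_of_support hI hI' he _ _).trans (le_of_eq ?_)
      rw [← ofReal_norm_sq, hφ.1]
      simp
    · simp_rw [setLIntegral_const, volume_occupied, ENNReal.tsum_mul_left]
      exact le_rfl
  exact hle.trans_lt (ENNReal.mul_lt_top hI'.lt_top hsum.lt_top)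

theorem optimalState_mem_states (hφ : Orthonormal ℂ φ)
    (hsum : ∑' j, ENNReal.ofReal (g j) ≠ ⊤) : optimalState g hφ ∈ states :=
  ⟨optimalState_isLocallyTraceClass hφ hsum, (optimalState_isStarProjection g hφ).nonneg,
    (optimalState_isStarProjection g hφ).le_one, optimalState_comm_translation g hφ⟩

/-- Mode `j` is filled for `|k| < π g j`, an interval of length `2π g j`, whence the factor `1/(2π)`
returns `g j`. Summability of `g` justifies integrating the series termwise. -/
theorem optimalState_hasReducedState (hφ : Orthonormal ℂ φ) (hg : ∀ j, 0 ≤ g j)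
    (hsum : ∑' j, ENNReal.ofReal (g j) ≠ ⊤) {G : L2 Plane →L[ℂ] L2 Plane}
    (hd : IsDiagonal G g φ) : HasReducedState (optimalState g hφ) G := by
  have : Fact ((2 : ℝ≥0∞) ≠ ⊤) := ⟨by simp⟩
  have : Countable ι := hφ.countable
  refine ⟨optimalFiber g φ, optimalState_isFiberFamily g hφ, fun u w => ?_⟩
  set B : ι → Set ℝ := fun j => {κ : ℝ | |κ| < Real.pi * g j} with hB
  have hBm : ∀ j, MeasurableSet (B j) := fun j => measurableSet_lt (by fun_prop) measurable_const
  have hBvol : ∀ j, volume (B j) = ENNReal.ofReal (2 * Real.pi * g j) := by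
    intro j
    have : B j = Set.Ioo (-(Real.pi * g j)) (Real.pi * g j) := by
      ext κ
      simp [hB, abs_lt]
    rw [this, Real.volume_Ioo]
    congr 1
    ring
  have hBreal : ∀ j, volume.real (B j) = 2 * Real.pi * g j := fun j => by
    have := hg j
    rw [Measure.real, hBvol, ENNReal.toReal_ofReal (by positivity)]
  set F : ι → ℝ → ℂ := fun j => (B j).indicator fun _ => ⟪u, φ j⟫ * ⟪φ j, w⟫ with hF
  have hFint : ∀ j, Integrable (F j) := fun j =>
    (integrable_indicator_iff (hBm j)).2 (integrableOn_const (by rw [hBvol]; simp))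
  have hbound : ∀ j, ‖⟪u, φ j⟫ * ⟪φ j, w⟫‖ ≤ ‖u‖ * ‖w‖ := by
    intro j
    rw [norm_mul]
    have h1 := norm_inner_le_norm (𝕜 := ℂ) u (φ j)
    have h2 := norm_inner_le_norm (𝕜 := ℂ) (φ j) w
    rw [hφ.1, mul_one] at h1
    rw [hφ.1, one_mul] at h2
    gcongr
  have hgs : Summable g := by
    have h1 := ENNReal.summable_toReal hsum
    exact h1.congr fun j => ENNReal.toReal_ofReal (hg j)
  have hFs : Summable fun j => ∫ k, ‖F j k‖ := by
    have h1 : ∀ j, ∫ k, ‖F j k‖ = 2 * Real.pi * g j * ‖⟪u, φ j⟫ * ⟪φ j, w⟫‖ := by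
      intro j
      simp_rw [hF, norm_indicator_eq_indicator_norm]
      rw [integral_indicator (hBm j), setIntegral_const, hBreal, smul_eq_mul]
    simp_rw [h1]
    refine Summable.of_nonneg_of_le (fun j => ?_) (fun j => ?_)
      ((hgs.mul_left (2 * Real.pi)).mul_right (‖u‖ * ‖w‖))
    · have := hg j
      positivity
    · have := hg j
      gcongr
      exact hbound j
  have hpt : ∀ k, HasSum (fun j => F j k) ⟪u, optimalFiber g φ k w⟫ := by
    intro k
    refine ((optimalFiber_isDiagonal hφ k).hasSum_inner u w).congr_fun fun j => ?_
    simp only [hF, hB]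
    by_cases hk : k ∈ {κ : ℝ | |κ| < Real.pi * g j} <;> simp [hk]
  have h1 := hasSum_integral_of_summable_integral_norm hFint hFs
  have h2 : (fun k => ∑' j, F j k) = fun k => ⟪u, optimalFiber g φ k w⟫ :=
    funext fun k => (hpt k).tsum_eq
  rw [h2] at h1
  refine ⟨?_, ?_⟩
  · have hm : AEStronglyMeasurable (fun k => ⟪u, optimalFiber g φ k w⟫) volume :=
      aestronglyMeasurable_const.inner (stronglyMeasurable_optimalFiber hφ w).aestronglyMeasurable
    refine ⟨hm, ?_⟩
    have h3 : ∀ k, ‖⟪u, optimalFiber g φ k w⟫‖ₑ ≤ ∑' j, ‖F j k‖ₑ := fun k => by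
      rw [← (hpt k).tsum_eq]
      exact enorm_tsum_le_tsum_enorm
    refine (lintegral_mono h3).trans_lt ?_
    rw [lintegral_tsum fun j => (hFint j).aestronglyMeasurable.enorm]
    simp_rw [← ofReal_integral_norm_eq_lintegral_enorm (hFint _)]
    exact hFs.tsum_ofReal_lt_top
  · have h4 := h1.mul_left (((1 / (2 * Real.pi) : ℝ) : ℂ))
    refine (hd.hasSum_inner u w).unique (h4.congr_fun fun j => ?_)
    simp only [hF]
    rw [integral_indicator (hBm j), setIntegral_const, hBreal, Complex.real_smul, ← mul_assoc _ _ (_ * _),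
      ← Complex.ofReal_mul]
    congr 2
    have := Real.pi_pos
    field_simp

end OptimalState

/-! ### Weak derivatives of the eigenvectors of `G`. -/

section WeakDerivative

variable {ι : Type} {φ : ι → L2 Plane} {g : ι → ℝ} {G : L2 Plane →L[ℂ] L2 Plane}

/-- The normalized `ψ` alone is an admissible family for the trace; of the form of `G`, only
direction `j` and mode `m` are kept. -/
theorem enorm_sq_inner_le_kineticTracePlane (hg : ∀ j, 0 ≤ g j) (hd : IsDiagonal G g φ) (m : ι)
    (j : Fin 2) (ψ : 𝓓((⊤ : TopologicalSpace.Opens Plane), ℂ)) :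
    ENNReal.ofReal (g m) * ‖⟪φ m, testDerivL2 ψ (EuclideanSpace.single j 1)⟫‖ₑ ^ 2 ≤
      kineticTracePlane G * ‖testL2 ψ‖ₑ ^ 2 := by
  set e : Plane := EuclideanSpace.single j 1 with he
  by_cases h0 : testL2 ψ = 0
  · have h1 : ψ = 0 := testL2_injective (h0.trans (testLinear ⊤).map_zero.symm)
    have h2 : testDerivL2 ψ e = 0 := by
      rw [h1]
      exact (testDerivLinear ⊤ e).map_zero
    simp [h2]
  · set r : ℂ := ((‖testL2 ψ‖⁻¹ : ℝ) : ℂ) with hr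
    have hnorm : ‖testL2 ψ‖ ≠ 0 := norm_ne_zero_iff.2 h0
    have hψ' : testL2 (r • ψ) = r • testL2 ψ := (testLinear ⊤).map_smul r ψ
    have hdψ' : testDerivL2 (r • ψ) e = r • testDerivL2 ψ e := (testDerivLinear ⊤ e).map_smul r ψ
    have h1 : Orthonormal ℂ fun _ : Fin 1 => testL2 (r • ψ) := by
      refine ⟨fun _ => ?_, fun i i' h => absurd (Subsingleton.elim i i') h⟩
      rw [hψ', norm_smul, hr, Complex.norm_real, norm_inv, norm_norm, inv_mul_cancel₀ hnorm]
    have h2 : ENNReal.ofReal (g m) * ‖⟪φ m, testDerivL2 (r • ψ) e⟫‖ₑ ^ 2 ≤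
        kineticTracePlane G := by
      refine le_trans ?_ (le_iSup_of_le 1 (le_iSup_of_le (fun _ => r • ψ) (le_iSup_of_le h1 le_rfl)))
      rw [Fin.sum_univ_one]
      refine le_trans ?_ (Finset.single_le_sum (f := fun j : Fin 2 => ENNReal.ofReal (RCLike.re
        ⟪testDerivL2 (r • ψ) (EuclideanSpace.single j 1),
          G (testDerivL2 (r • ψ) (EuclideanSpace.single j 1))⟫)) (fun _ _ => zero_le)
        (Finset.mem_univ j))
      rw [hd.ofReal_inner hg]
      exact ENNReal.le_tsum (f := fun i => ENNReal.ofReal (g i) *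
        ‖⟪φ i, testDerivL2 (r • ψ) e⟫‖ₑ ^ 2) m
    have h3 : ‖r‖ₑ ^ 2 * ‖testL2 ψ‖ₑ ^ 2 = 1 := by
      rw [← mul_pow, ← enorm_smul, ← hψ', ← ofReal_norm_sq, h1.1 0]
      simp
    calc _ = (ENNReal.ofReal (g m) * ‖⟪φ m, testDerivL2 ψ e⟫‖ₑ ^ 2) *
          (‖r‖ₑ ^ 2 * ‖testL2 ψ‖ₑ ^ 2) := by rw [h3, mul_one]
      _ = (ENNReal.ofReal (g m) * ‖⟪φ m, testDerivL2 (r • ψ) e⟫‖ₑ ^ 2) * ‖testL2 ψ‖ₑ ^ 2 := by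
          rw [hdψ', inner_smul_right, enorm_mul]
          ring
      _ ≤ _ := by gcongr

theorem denseRange_testLinear :
    DenseRange (testLinear (⊤ : TopologicalSpace.Opens Plane)) := by
  intro x
  exact mem_closure_testFunctions x (Filter.Eventually.of_forall fun y hy => absurd trivial hy)

/-- If `Tr(-Δ₂ G)` is finite, the eigenvectors of `G` for positive eigenvalues have weak
derivatives in `L²`. -/
theorem exists_weakDerivative (hg : ∀ j, 0 ≤ g j) (hd : IsDiagonal G g φ)
    (htr : kineticTracePlane G ≠ ⊤) (m : ι) (hm : 0 < g m) (j : Fin 2) :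
    ∃ D : L2 Plane, ∀ ψ : 𝓓((⊤ : TopologicalSpace.Opens Plane), ℂ),
      ⟪φ m, testDerivL2 ψ (EuclideanSpace.single j 1)⟫ = ⟪D, testL2 ψ⟫ := by
  set e : Plane := EuclideanSpace.single j 1 with he
  set ℓ : 𝓓((⊤ : TopologicalSpace.Opens Plane), ℂ) →ₗ[ℂ] ℂ :=
    (innerSL ℂ (φ m)).toLinearMap ∘ₗ testDerivLinear ⊤ e with hℓ
  have hbound : ∃ C, ∀ ψ, ‖ℓ ψ‖ ≤ C * ‖testLinear ⊤ ψ‖ := by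
    refine ⟨Real.sqrt ((kineticTracePlane G).toReal / g m), fun ψ => ?_⟩
    refine le_of_sq_le_sq ?_ (by positivity)
    rw [mul_pow, Real.sq_sqrt (by positivity), div_mul_eq_mul_div, le_div_iff₀ hm, mul_comm]
    have h1 := enorm_sq_inner_le_kineticTracePlane hg hd m j ψ
    rw [← ofReal_norm_sq, ← ofReal_norm_sq, ← ENNReal.ofReal_mul (hg m),
      ← ENNReal.ofReal_toReal htr, ← ENNReal.ofReal_mul (by positivity),
      ENNReal.ofReal_le_ofReal_iff (by positivity)] at h1
    exact h1
  -- `D` is the Riesz representative of the bounded extension of `ψ ↦ ⟨φ m, ∂ψ⟩`; it equals minus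
  -- the weak derivative of `φ m`.
  refine ⟨(InnerProductSpace.toDual ℂ (L2 Plane)).symm (ℓ.extendOfNorm (testLinear ⊤)), fun ψ => ?_⟩
  rw [InnerProductSpace.toDual_symm_apply]
  exact (LinearMap.extendOfNorm_eq denseRange_testLinear hbound ψ).symm

/-- On a complete test family, Parseval for each `D m j` bounds the sum by the kinetic trace. Where
`g m = 0` the choice of `D m` is irrelevant, because its weight vanishes. -/
theorem exists_weakDerivatives (hg : ∀ j, 0 ≤ g j) (hd : IsDiagonal G g φ)
    (htr : kineticTracePlane G ≠ ⊤) :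
    ∃ D : ι → Fin 2 → L2 Plane,
      (∀ m, 0 < g m → ∀ (j : Fin 2) (ψ : 𝓓((⊤ : TopologicalSpace.Opens Plane), ℂ)),
        ⟪φ m, testDerivL2 ψ (EuclideanSpace.single j 1)⟫ = ⟪D m j, testL2 ψ⟫) ∧
      ∑' m, ENNReal.ofReal (g m) * ∑ j, ‖D m j‖ₑ ^ 2 ≤ kineticTracePlane G := by
  have h : ∀ (m : ι) (j : Fin 2), ∃ D : L2 Plane, 0 < g m →
      ∀ ψ : 𝓓((⊤ : TopologicalSpace.Opens Plane), ℂ),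
        ⟪φ m, testDerivL2 ψ (EuclideanSpace.single j 1)⟫ = ⟪D, testL2 ψ⟫ := by
    intro m j
    by_cases hm : 0 < g m
    · obtain ⟨D, hD⟩ := exists_weakDerivative hg hd htr m hm j
      exact ⟨D, fun _ => hD⟩
    · exact ⟨0, fun h => absurd h hm⟩
  choose D hD using h
  refine ⟨D, fun m hm j => hD m j hm, ?_⟩
  obtain ⟨κ, u, -, hu, -, -, hucomp⟩ := exists_testBasis
    (Ω := (⊤ : TopologicalSpace.Opens Plane)) (n := 0)
    (fun i => i.elim0) (by rw [orthonormal_iff_ite]; exact fun i => i.elim0)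
  refine le_trans (le_of_eq ?_) (tsum_le_kineticTrace _ G u hu)
  simp_rw [hd.ofReal_inner hg, ← tsum_fintype (L := .unconditional _)]
  simp_rw [ENNReal.tsum_comm (α := Fin 2) (β := ι)]
  rw [ENNReal.tsum_comm (α := κ) (β := ι)]
  refine tsum_congr fun m => ?_
  rw [ENNReal.tsum_comm (α := κ) (β := Fin 2), ← ENNReal.tsum_mul_left]
  refine tsum_congr fun j => ?_
  rw [ENNReal.tsum_mul_left]
  rcases (hg m).eq_or_lt with hm | hm
  · simp [← hm]
  · congr 1
    rw [← hu.tsum_enorm_inner_sq (hucomp (D m j) (Filter.Eventually.of_forall fun y hy =>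
      absurd trivial hy))]
    refine tsum_congr fun a => ?_
    rw [hD m j hm (u a), ← inner_conj_symm, RCLike.enorm_conj]

end WeakDerivative

/-! ### Integration by parts for test functions on the slab. -/

section SlabTest

variable (e : 𝓓(unitSlab, ℂ))

theorem unitSlab_zero {p : Space} (hp : p.2 ∉ Set.Ioo (0 : ℝ) 1) : e p = 0 :=
  image_eq_zero_of_notMem_tsupport fun h => hp (e.tsupport_subset h).2

theorem unitSlab_fderiv_zero {p : Space} (hp : p.2 ∉ Set.Ioo (0 : ℝ) 1) : fderiv ℝ e p = 0 :=
  image_eq_zero_of_notMem_tsupport fun h => hp (e.tsupport_subset (tsupport_fderiv_subset ℝ h)).2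

/-- The section `e(·, t)` of a test function. -/
def sectionTest (t : ℝ) : 𝓓((⊤ : TopologicalSpace.Opens Plane), ℂ) where
  toFun x := e (x, t)
  contDiff' := e.contDiff.comp (contDiff_id.prodMk contDiff_const)
  hasCompactSupport' := by
    refine HasCompactSupport.intro (e.hasCompactSupport.isCompact.image continuous_fst)
      fun x hx => ?_
    exact image_eq_zero_of_notMem_tsupport fun h => hx ⟨(x, t), h, rfl⟩
  tsupport_subset' := fun _ _ => trivial

theorem sliceL2_testL2 : sliceL2 (testL2 e) =ᵐ[volume] fun t => testL2 (sectionTest e t) :=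
  sliceL2_ae_eq (coeFn_testL2 e) (Filter.Eventually.of_forall fun t =>
    coeFn_testL2 (sectionTest e t))

theorem fderiv_sectionTest (t : ℝ) (x v : Plane) :
    fderiv ℝ (sectionTest e t) x v = fderiv ℝ e (x, t) (v, 0) := by
  have h1 : HasFDerivAt (fun x : Plane => ((x, t) : Space)) (ContinuousLinearMap.inl ℝ Plane ℝ) x :=
    hasFDerivAt_prodMk_left x t
  have h2 : HasFDerivAt (sectionTest e t) (fderiv ℝ e (x, t) ∘L ContinuousLinearMap.inl ℝ Plane ℝ)
      x := (testFunction_differentiable e (x, t)).hasFDerivAt.comp x h1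
  rw [h2.fderiv]
  simp

theorem sliceL2_testDerivL2 (v : Plane) :
    sliceL2 (testDerivL2 e (v, 0)) =ᵐ[volume] fun t => testDerivL2 (sectionTest e t) v := by
  refine sliceL2_ae_eq (coeFn_testDerivL2 e (v, 0)) (Filter.Eventually.of_forall fun t => ?_)
  refine (coeFn_testDerivL2 (sectionTest e t) v).trans ?_
  exact Filter.Eventually.of_forall fun x => fderiv_sectionTest e t x v

/-- A transverse derivative acts slice by slice, and each slice is a test function on the plane, so
`hD` applies for almost every `t`. -/
theorem inner_tensor_testDerivL2_fst {u D : L2 Plane} {v : Plane}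
    (hD : ∀ ψ : 𝓓((⊤ : TopologicalSpace.Opens Plane), ℂ), ⟪u, testDerivL2 ψ v⟫ = ⟪D, testL2 ψ⟫)
    (z : L2 ℝ) : ⟪tensor u z, testDerivL2 e (v, 0)⟫ = ⟪tensor D z, testL2 e⟫ := by
  rw [tensor_inner, tensor_inner]
  refine integral_congr_ae ?_
  filter_upwards [sliceL2_testL2 e, sliceL2_testDerivL2 e v] with t h1 h2
  rw [h1, h2, hD]

theorem inner_tensor_wave (u : L2 Plane) (ξ : ℝ) {f : L2 Space} {F : Space → ℂ}
    (hf : f =ᵐ[volume] F) (hF : ∀ p : Space, p.2 ∉ Set.Ioo (0 : ℝ) 1 → F p = 0) :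
    ⟪tensor u (wave measurableSet_Ioo volume_Ioo_ne_top ξ), f⟫ =
      ∫ x : Plane, starRingEnd ℂ (u x) * 𝓕 (fun t : ℝ => F (x, t)) ξ := by
  have hae : (fun p => ⟪tensor u (wave measurableSet_Ioo volume_Ioo_ne_top ξ) p, f p⟫)
      =ᵐ[volume] fun p : Space =>
        starRingEnd ℂ (u p.1) * (Real.fourierChar (-(p.2 * ξ)) • F p) := by
    filter_upwards [hf, tensor_ae_eq (w := u) Filter.EventuallyEq.rfl
      (coeFn_wave measurableSet_Ioo volume_Ioo_ne_top ξ)] with p h1 h2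
    rw [h1, h2, RCLike.inner_apply, map_mul]
    by_cases hp : p.2 ∈ Set.Ioo (0 : ℝ) 1
    · rw [Set.indicator_of_mem hp, conj_fourierChar, Circle.smul_def, smul_eq_mul]
      ring
    · rw [hF p hp]
      simp
  have hint := (L2.integrable_inner (𝕜 := ℂ)
    (tensor u (wave measurableSet_Ioo volume_Ioo_ne_top ξ)) f).congr hae
  rw [L2.inner_def, integral_congr_ae hae, Measure.volume_eq_prod]
  rw [Measure.volume_eq_prod] at hint
  rw [integral_prod _ hint]
  congr 1 with x
  rw [Real.fourier_real_eq, ← integral_const_mul]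

/-- For fixed `x` the function of `t` has compact support in `(0,1)`, so cutting off the plane wave
creates no boundary term and the derivative becomes `2πiξ`. -/
theorem inner_tensor_testDerivL2_snd (u : L2 Plane) (ξ : ℝ) :
    ⟪tensor u (wave measurableSet_Ioo volume_Ioo_ne_top ξ), testDerivL2 e (0, 1)⟫ =
      (2 * Real.pi * Complex.I * ξ) *
        ⟪tensor u (wave measurableSet_Ioo volume_Ioo_ne_top ξ), testL2 e⟫ := by
  rw [inner_tensor_wave u ξ (coeFn_testL2 e) (fun p hp => unitSlab_zero e hp),
    inner_tensor_wave u ξ (coeFn_testDerivL2 e (0, 1))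
      (fun p hp => by rw [unitSlab_fderiv_zero e hp]; rfl), ← integral_const_mul]
  congr 1 with x
  have hsupp : HasCompactSupport fun t : ℝ => e (x, t) := by
    refine HasCompactSupport.intro (e.hasCompactSupport.isCompact.image continuous_snd)
      fun t ht => ?_
    exact image_eq_zero_of_notMem_tsupport fun h => ht ⟨(x, t), h, rfl⟩
  have hsm : ContDiff ℝ (⊤ : ℕ∞) fun t : ℝ => e (x, t) :=
    e.contDiff.comp (contDiff_const.prodMk contDiff_id)
  have hderiv : deriv (fun t : ℝ => e (x, t)) = fun t => fderiv ℝ e (x, t) (0, 1) := by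
    funext t
    have h1 : HasFDerivAt (fun t : ℝ => ((x, t) : Space)) (ContinuousLinearMap.inr ℝ Plane ℝ) t :=
      hasFDerivAt_prodMk_right x t
    have h2 := ((testFunction_differentiable e (x, t)).hasFDerivAt.comp t h1).hasDerivAt
    refine (h2.deriv : deriv (fun t : ℝ => e (x, t)) t = _).trans ?_
    simp
  rw [← hderiv, Real.fourier_deriv (hsm.continuous.integrable_of_hasCompactSupport hsupp)
    (hsm.differentiable (by simp))
    ((hsm.continuous_deriv (by simp)).integrable_of_hasCompactSupport hsupp.deriv)]
  simp only [smul_eq_mul]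
  ring

end SlabTest

/-! ### Upper bound for the energy of the optimal state. -/

section UpperBound

variable {ι : Type} {φ : ι → L2 Plane} {g : ι → ℝ} {G : L2 Plane →L[ℂ] L2 Plane}

theorem ae_inner_fiberEquiv_testDerivL2 {n : ℕ} (e : Fin n → 𝓓(unitSlab, ℂ)) (u : L2 Plane)
    (v : Space) :
    ∀ᵐ ξ : ℝ, ∀ i, ⟪u, fiberEquiv (testDerivL2 (e i) v) ξ⟫ =
      ⟪tensor u (wave measurableSet_Ioo volume_Ioo_ne_top ξ), testDerivL2 (e i) v⟫ := by
  refine ae_all_iff.2 fun i => inner_fiberEquiv measurableSet_Ioo volume_Ioo_ne_top ?_ u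
  filter_upwards [coeFn_testDerivL2 (e i) v] with p hp hn
  rw [hp, unitSlab_fderiv_zero _ hn]
  rfl

/-- Once the derivative sits on `φ m`, Bessel bounds the sum at each frequency by `‖D m‖²`, and mode
`m` occupies frequencies of total length `g m`. -/
theorem sum_transverse_le (hφ : Orthonormal ℂ φ) {n : ℕ} {e : Fin n → 𝓓(unitSlab, ℂ)}
    (he : Orthonormal ℂ fun i => testL2 (e i)) {v : Plane} {D : ι → L2 Plane}
    (hD : ∀ m, 0 < g m → ∀ ψ : 𝓓((⊤ : TopologicalSpace.Opens Plane), ℂ),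
        ⟪φ m, testDerivL2 ψ v⟫ = ⟪D m, testL2 ψ⟫) :
    ∑ i, ENNReal.ofReal (RCLike.re
        ⟪testDerivL2 (e i) (v, 0), optimalState g hφ (testDerivL2 (e i) (v, 0))⟫) ≤
      ∑' m, ENNReal.ofReal (g m) * ‖D m‖ₑ ^ 2 := by
  refine (sum_inner_optimalState_le g hφ _ (fun m _ => ‖D m‖ₑ ^ 2) fun m hm => ?_).trans ?_
  · filter_upwards [ae_inner_fiberEquiv_testDerivL2 e (φ m) (v, 0)] with ξ hξ
    simp_rw [hξ, inner_tensor_testDerivL2_fst _ (hD m hm)]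
    refine (sum_inner_le_of_support measurableSet_Ioo volume_Ioo_ne_top he _ _).trans
      (le_of_eq ?_)
    simp
  · refine ENNReal.tsum_le_tsum fun m => ?_
    rw [setLIntegral_const, volume_occupied, mul_comm]

theorem sum_longitudinal_le (hφ : Orthonormal ℂ φ) (hg : ∀ j, 0 ≤ g j) {n : ℕ}
    {e : Fin n → 𝓓(unitSlab, ℂ)} (he : Orthonormal ℂ fun i => testL2 (e i)) :
    ∑ i, ENNReal.ofReal (RCLike.re
        ⟪testDerivL2 (e i) (0, 1), optimalState g hφ (testDerivL2 (e i) (0, 1))⟫) ≤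
      ∑' m, ENNReal.ofReal (Real.pi ^ 2 / 3) * ENNReal.ofReal (g m ^ 3) := by
  refine (sum_inner_optimalState_le g hφ _
    (fun m ξ => ENNReal.ofReal ((2 * Real.pi * ξ) ^ 2)) fun m _ => ?_).trans ?_
  · filter_upwards [ae_inner_fiberEquiv_testDerivL2 e (φ m) (0, 1)] with ξ hξ
    have h1 : ‖(2 * Real.pi * Complex.I * ξ : ℂ)‖ₑ ^ 2 =
        ENNReal.ofReal ((2 * Real.pi * ξ) ^ 2) := by
      rw [← ofReal_norm_sq]
      congr 1
      rw [norm_mul, norm_mul, norm_mul, Complex.norm_I, Complex.norm_real, Complex.norm_real,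
        Complex.norm_ofNat, mul_one, ← sq_abs (2 * Real.pi * ξ), abs_mul, abs_mul, abs_two]
      rfl
    have h2 : ∀ i, ‖⟪tensor (φ m) (wave measurableSet_Ioo volume_Ioo_ne_top ξ),
        testDerivL2 (e i) (0, 1)⟫‖ₑ ^ 2 = ENNReal.ofReal ((2 * Real.pi * ξ) ^ 2) *
          ‖⟪tensor (φ m) (wave measurableSet_Ioo volume_Ioo_ne_top ξ), testL2 (e i)⟫‖ₑ ^ 2 :=
      fun i => by rw [inner_tensor_testDerivL2_snd, enorm_mul, mul_pow, h1]
    simp_rw [hξ, h2, ← Finset.mul_sum]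
    refine (mul_le_mul_right (sum_inner_le_of_support measurableSet_Ioo volume_Ioo_ne_top
      he (φ m) ξ) _).trans (le_of_eq ?_)
    rw [← ofReal_norm_sq, hφ.1]
    simp
  · exact ENNReal.tsum_le_tsum fun m => (lintegral_kinetic_ball (hg m)).le

theorem kineticEnergy_optimalState_le (hφ : Orthonormal ℂ φ) (hg : ∀ j, 0 ≤ g j)
    (hd : IsDiagonal G g φ) :
    kineticEnergy (optimalState g hφ) ≤
      (1 / 2) * kineticTracePlane G + ENNReal.ofReal (Real.pi ^ 2 / 6) * posTrace (G ^ 3) := by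
  by_cases htr : kineticTracePlane G = ⊤
  · rw [htr, ENNReal.mul_top (by simp), top_add]
    exact le_top
  obtain ⟨D, hD, hDle⟩ := exists_weakDerivatives hg hd htr
  have h : kineticTrace spaceBasis unitSlab (optimalState g hφ) ≤ kineticTracePlane G +
      ∑' m, ENNReal.ofReal (Real.pi ^ 2 / 3) * ENNReal.ofReal (g m ^ 3) := by
    refine iSup_le fun n => iSup_le fun e => iSup_le fun he => ?_
    rw [Finset.sum_comm, Fin.sum_univ_three]
    have e0 : spaceBasis 0 = (EuclideanSpace.single 0 1, 0) := rfl
    have e1 : spaceBasis 1 = (EuclideanSpace.single 1 1, 0) := rfl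
    have e2 : spaceBasis 2 = (0, 1) := rfl
    rw [e0, e1, e2]
    refine add_le_add (le_trans ?_ hDle) (sum_longitudinal_le hφ hg he)
    simp_rw [Fin.sum_univ_two, mul_add]
    rw [ENNReal.tsum_add]
    exact add_le_add (sum_transverse_le hφ he fun m hm => hD m hm 0)
      (sum_transverse_le hφ he fun m hm => hD m hm 1)
  rw [ENNReal.tsum_mul_left, ← (hd.pow_three hφ).posTrace_eq (fun j => pow_nonneg (hg j) 3) hφ] at h
  rw [kineticEnergy, ofReal_pi_sq_div_six, mul_assoc, ← mul_add]
  gcongr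

end UpperBound

end

/-! ### Conclusion: both bounds meet at the optimal state. -/

theorem theorem3p3 (G : L2 Plane →L[ℂ] L2 Plane) (hG : G ∈ reducedStates) :
    (⨅ γ ∈ {γ : L2 Space →L[ℂ] L2 Space | γ ∈ states ∧ HasReducedState γ G}, kineticEnergy γ) =
        (1 / 2) * kineticTracePlane G + ENNReal.ofReal (Real.pi ^ 2 / 6) * posTrace (G ^ 3) ∧
      (∃ (g : ℕ → ℝ) (φ : ℕ → L2 Plane),
        Orthonormal ℂ φ ∧ (∀ j, 0 ≤ g j) ∧ IsDiagonal G g φ) ∧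
      ∀ (ι : Type) (g : ι → ℝ) (φ : ι → L2 Plane),
        Orthonormal ℂ φ → (∀ j, 0 ≤ g j) → IsDiagonal G g φ →
        ∃ (γ : L2 Space →L[ℂ] L2 Space) (γk : ℝ → L2 Plane →L[ℂ] L2 Plane),
          γ ∈ states ∧ HasReducedState γ G ∧ IsFiberFamily γ γk ∧
          (∀ k : ℝ, IsDiagonal (γk k)
            (fun j => Set.indicator {κ : ℝ | |κ| < Real.pi * g j} 1 k) φ) ∧
          kineticEnergy γ =
            (1 / 2) * kineticTracePlane G +
              ENNReal.ofReal (Real.pi ^ 2 / 6) * posTrace (G ^ 3) := by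
  have key : ∀ (ι : Type) (g : ι → ℝ) (φ : ι → L2 Plane) (hφ : Orthonormal ℂ φ),
      (∀ j, 0 ≤ g j) → IsDiagonal G g φ →
      optimalState g hφ ∈ states ∧ HasReducedState (optimalState g hφ) G ∧
        kineticEnergy (optimalState g hφ) = (1 / 2) * kineticTracePlane G +
          ENNReal.ofReal (Real.pi ^ 2 / 6) * posTrace (G ^ 3) := by
    intro ι g φ hφ hg hd
    -- For every diagonalization this sum is `Tr G`; it makes the optimal state locally trace class
    -- and its fibers weakly integrable.
    have hsum : ∑' j, ENNReal.ofReal (g j) ≠ ⊤ := by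
      rw [← hd.posTrace_eq hg hφ]
      exact hG.2.ne
    have h1 := optimalState_mem_states hφ hsum
    have h2 := optimalState_hasReducedState hφ hg hsum hd
    exact ⟨h1, h2, le_antisymm (kineticEnergy_optimalState_le hφ hg hd)
      (kineticEnergy_ge h1 h2 hφ hg hd)⟩
  obtain ⟨g, φ, hφ, hg, hd⟩ := exists_isDiagonal hG
  refine ⟨le_antisymm ?_ ?_, ⟨g, φ, hφ, hg, hd⟩, fun ι g φ hφ hg hd => ?_⟩
  · obtain ⟨h1, h2, h3⟩ := key ℕ g φ hφ hg hd
    exact (iInf₂_le _ ⟨h1, h2⟩).trans h3.le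
  · exact le_iInf₂ fun γ hγ => kineticEnergy_ge hγ.1 hγ.2 hφ hg hd
  · obtain ⟨h1, h2, h3⟩ := key ι g φ hφ hg hd
    exact ⟨optimalState g hφ, optimalFiber g φ, h1, h2, optimalState_isFiberFamily g hφ,
      optimalFiber_isDiagonal hφ, h3⟩
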